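/- **Theorem (Block encoding of $G$).** For real $\alpha\ge 0$, $m\ge 0$ and $\varepsilon\ge 0$, a unitary $U$ on $m$ ancilla qubits and $n$ system qubits is called an $(\alpha,m,\varepsilon)$-block encoding of an $n$-qubit operator $A$ if $\alpha\ge\|A\|$ and $\|A-\alpha(\langle 0^m|\otimes I_n)U(|0^m\rangle\otimes I_n)\|\le\varepsilon$, where $\|\cdot\|$ is the operator norm. An elementary gate is an arbitrary unitary on at most two qubits, and $A^+$ is the Moore–Penrose inverse of $A$. A query to a unitary $U$ is one application of $U$ to chosen distinct qubits. There is an absolute constant $C>0$ such that the following holds. Let $n,m_1,m_2\ge 0$ be integers, $\alpha_H>0$, $\alpha_I\ge 0$, $\Delta>0$ and $\epsilon\in(0,\tfrac12]$, and put $$L=\max\Bigl\{1,\ \log\frac{\alpha_I}{\Delta\epsilon}\Bigr\}\qquad(L=1\text{ if }\alpha_I=0).$$ There is a quantum circuit on $m_1+m_2+1$ ancilla qubits and $n$ system qubits, with two black-box unitaries $U_H$ (on $m_1+n$ qubits) and $U_I$ (on $m_2+n$ qubits), depending only on $n,m_1,m_2,\alpha_H,\alpha_I,\Delta,\epsilon$,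 that uses * at most $C\,\frac{\alpha_H}{\Delta}\,L$ queries to $U_H$ and $U_H^\dagger$, * exactly one query to $U_I$ and none to $U_I^\dagger$, * at most $C\,(n+m_1+m_2+1)\,\frac{\alpha_H}{\Delta}\,L$ elementary gates, and has the following property. Let $H$ be an $n$-qubit Hamiltonian (Hermitian operator) with nondegenerate ground state, lowest eigenvalue $E_0$ and next eigenvalue $E_1$, with $\Delta\le E_1-E_0$, and let $H_I$ be an $n$-qubit operator. If $U_H$ is an $(\alpha_H,m_1,0)$-block encoding of $H-E_0$ and $U_I$ is an $(\alpha_I,m_2,0)$-block encoding of $H_I$, then the unitary $U_Q$ implemented by the circuit is an $(\alpha_Q,m_1+m_2+1,0)$-block encoding of an $n$-qubit operator $Q$ with $$\alpha_Q=\frac{4\alpha_I}{3\Delta},\qquad \|Q-G\|\le\epsilon,\qquad G=(H-E_0)^+H_I .$$ -/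

import Mathlib

open scoped Matrix Matrix.Norms.L2Operator

/-! Matrices carry the `ℓ²` operator (spectral) norm throughout. -/

/-! ### Moore–Penrose inverse -/

section MoorePenrose

variable {ι : Type*} [Fintype ι]

/-- The four Penrose equations: `B` is the Moore–Penrose inverse of `A`. -/
structure IsMoorePenrose (A B : Matrix ι ι ℂ) : Prop where
  mul_mul_left : A * B * A = A
  mul_mul_right : B * A * B = B
  conj_left : (A * B)ᴴ = A * B
  conj_right : (B * A)ᴴ = B * A

theorem IsMoorePenrose.unique {A B C : Matrix ι ι ℂ} (hB : IsMoorePenrose A B)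
    (hC : IsMoorePenrose A C) : B = C := by
  have h1 : A * B = A * C := by
    calc A * B = (A * B)ᴴ := hB.conj_left.symm
      _ = (A * C * (A * B))ᴴ := by rw [← mul_assoc, hC.mul_mul_left]
      _ = (A * B) * (A * C) := by
          rw [Matrix.conjTranspose_mul, hB.conj_left, hC.conj_left]
      _ = A * C := by rw [← mul_assoc, hB.mul_mul_left]
  have h2 : B * A = C * A := by
    calc B * A = (B * A)ᴴ := hB.conj_right.symm
      _ = (B * A * (C * A))ᴴ := by
          rw [mul_assoc, ← mul_assoc A C A, hC.mul_mul_left]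
      _ = (C * A) * (B * A) := by
          rw [Matrix.conjTranspose_mul, hB.conj_right, hC.conj_right]
      _ = C * A := by rw [mul_assoc, ← mul_assoc A B A, hB.mul_mul_left]
  calc B = B * A * B := hB.mul_mul_right.symm
    _ = C * A * B := by rw [h2]
    _ = C * (A * B) := by rw [mul_assoc]
    _ = C * A * C := by rw [h1, mul_assoc]
    _ = C := hC.mul_mul_right

theorem exists_isMoorePenrose_of_isHermitian [DecidableEq ι] {M : Matrix ι ι ℂ} (hM : M.IsHermitian) :
    ∃ N : Matrix ι ι ℂ, Nᴴ = N ∧ M * N = N * M ∧ M * N * M = M ∧ N * M * N = N := by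
  set V : Matrix ι ι ℂ := (hM.eigenvectorUnitary : Matrix ι ι ℂ) with hV
  set d : ι → ℂ := fun i => (hM.eigenvalues i : ℂ) with hd
  have hVV : Vᴴ * V = 1 := Unitary.coe_star_mul_self hM.eigenvectorUnitary
  have hMs : M = V * Matrix.diagonal d * Vᴴ := by
    have h := hM.spectral_theorem
    rw [Unitary.conjStarAlgAut_apply] at h
    exact h
  have key : ∀ X Y : Matrix ι ι ℂ, (V * X * Vᴴ) * (V * Y * Vᴴ) = V * (X * Y) * Vᴴ := by
    intro X Y
    calc (V * X * Vᴴ) * (V * Y * Vᴴ) = V * X * (Vᴴ * V) * Y * Vᴴ := by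
          simp only [mul_assoc]
      _ = V * (X * Y) * Vᴴ := by rw [hVV, mul_one]; simp only [mul_assoc]
  refine ⟨V * Matrix.diagonal (fun i => (d i)⁻¹) * Vᴴ, ?_, ?_, ?_, ?_⟩
  · rw [Matrix.conjTranspose_mul, Matrix.conjTranspose_mul, Matrix.conjTranspose_conjTranspose,
      Matrix.diagonal_conjTranspose, mul_assoc]
    congr 3
    ext i
    simp [hd]
  · rw [hMs, key, key, Matrix.diagonal_mul_diagonal, Matrix.diagonal_mul_diagonal]
    simp only [mul_comm]
  · rw [hMs, key, key, Matrix.diagonal_mul_diagonal, Matrix.diagonal_mul_diagonal]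
    simp only [mul_inv_mul_cancel]
  · rw [hMs, key, key, Matrix.diagonal_mul_diagonal, Matrix.diagonal_mul_diagonal]
    congr 3
    ext i
    by_cases h : d i = 0 <;> simp [h]

open scoped ComplexOrder in
theorem exists_isMoorePenrose [DecidableEq ι] (A : Matrix ι ι ℂ) : ∃ B, IsMoorePenrose A B := by
  obtain ⟨N, hN, hc, h1, h2⟩ :=
    exists_isMoorePenrose_of_isHermitian (Matrix.isHermitian_conjTranspose_mul_self A)
  have hM : (Aᴴ * A)ᴴ = Aᴴ * A := Matrix.isHermitian_conjTranspose_mul_self A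
  have hA : A * N * (Aᴴ * A) = A := by
    have h0 : (A * N * (Aᴴ * A) - A)ᴴ * (A * N * (Aᴴ * A) - A) = 0 := by
      have h3 : Aᴴ * (A * N * (Aᴴ * A) - A) = 0 := by
        rw [mul_sub, ← mul_assoc, ← mul_assoc Aᴴ A N, h1, sub_self]
      have h4 : A * N * (Aᴴ * A) - A = A * (N * (Aᴴ * A) - 1) := by
        rw [mul_sub, mul_one, mul_assoc]
      nth_rewrite 1 [h4]
      rw [Matrix.conjTranspose_mul, mul_assoc, h3, mul_zero]
    exact sub_eq_zero.mp (Matrix.conjTranspose_mul_self_eq_zero.mp h0)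
  refine ⟨N * Aᴴ, ?_, ?_, ?_, ?_⟩
  · rw [← mul_assoc, mul_assoc (A * N), hA]
  · rw [← mul_assoc, mul_assoc N Aᴴ A, h2]
  · simp only [Matrix.conjTranspose_mul, Matrix.conjTranspose_conjTranspose, hN, mul_assoc]
  · rw [mul_assoc, Matrix.conjTranspose_mul, hM, hN, hc]

/-- The Moore–Penrose inverse of a square complex matrix. -/
noncomputable def pinv [DecidableEq ι] (A : Matrix ι ι ℂ) : Matrix ι ι ℂ :=
  (exists_isMoorePenrose A).choose

theorem pinv_spec [DecidableEq ι] (A : Matrix ι ι ℂ) : IsMoorePenrose A (pinv A) :=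
  (exists_isMoorePenrose A).choose_spec

end MoorePenrose

/-! ### Qubits and block encodings -/

/-- Operators on the qubits labelled by `W`, as matrices in the computational basis `{0,1}^W`.
An `n`-qubit operator is a `QOp (Fin n)`. -/
abbrev QOp (W : Type) : Type := Matrix (W → Fin 2) (W → Fin 2) ℂ

/-- `(⟨0^m| ⊗ I_n) U (|0^m⟩ ⊗ I_n)`; the left summand `Fin m` labels the ancilla qubits. -/
def zeroBlock {m n : ℕ} (U : QOp (Fin m ⊕ Fin n)) : QOp (Fin n) :=
  U.submatrix (fun x => Sum.elim (fun _ => 0) x) (fun x => Sum.elim (fun _ => 0) x)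

/-- `U` is an `(α, m, ε)`-block encoding of the `n`-qubit operator `A`. -/
structure IsBlockEncoding {n : ℕ} (α : ℝ) (m : ℕ) (ε : ℝ) (A : QOp (Fin n))
    (U : QOp (Fin m ⊕ Fin n)) : Prop where
  unitary : U ∈ Matrix.unitaryGroup (Fin m ⊕ Fin n → Fin 2) ℂ
  norm_le : ‖A‖ ≤ α
  error_le : ‖A - (α : ℂ) • zeroBlock U‖ ≤ ε

/-! ### Circuits with oracle gates -/

open Classical in
/-- The operator `U` acting on the wires `e v`, tensored with the identity on all other wires. -/
noncomputable def placeOp {V W : Type} (e : V ↪ W) (U : QOp V) : QOp W :=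
  Matrix.of fun x y => if ∀ w, w ∉ Set.range e → x w = y w then U (x ∘ e) (y ∘ e) else 0

/-- The gates of a circuit with wires `W` and two black boxes, `A` on the qubits `V₁` and `B` on
the qubits `V₂`: an elementary gate is an arbitrary unitary on at most two wires, and a query
applies a black box or its inverse to chosen distinct wires. -/
inductive OracleGate (V₁ V₂ W : Type) : Type
  | elementary (k : ℕ) (hk : k ≤ 2) (e : Fin k ↪ W)
      (u : Matrix.unitaryGroup (Fin k → Fin 2) ℂ) : OracleGate V₁ V₂ W
  | queryA (e : V₁ ↪ W) : OracleGate V₁ V₂ W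
  | queryAInv (e : V₁ ↪ W) : OracleGate V₁ V₂ W
  | queryB (e : V₂ ↪ W) : OracleGate V₁ V₂ W
  | queryBInv (e : V₂ ↪ W) : OracleGate V₁ V₂ W

namespace OracleGate

variable {V₁ V₂ W : Type}

/-- The operator implemented by a gate when the black boxes are `A` and `B`. -/
noncomputable def toOp (A : QOp V₁) (B : QOp V₂) : OracleGate V₁ V₂ W → QOp W
  | elementary _ _ e u => placeOp e u
  | queryA e => placeOp e A
  | queryAInv e => placeOp e Aᴴ
  | queryB e => placeOp e B
  | queryBInv e => placeOp e Bᴴ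

def isElementary : OracleGate V₁ V₂ W → Bool
  | elementary _ _ _ _ => true
  | _ => false

/-- A query to `A` or to its inverse. -/
def isQueryA : OracleGate V₁ V₂ W → Bool
  | queryA _ => true
  | queryAInv _ => true
  | _ => false

/-- A query to `B`, not to its inverse. -/
def isQueryB : OracleGate V₁ V₂ W → Bool
  | queryB _ => true
  | _ => false

/-- A query to the inverse of `B`. -/
def isQueryBInv : OracleGate V₁ V₂ W → Bool
  | queryBInv _ => true
  | _ => false

end OracleGate

/-- A circuit is a list of gates; the head of the list is applied first. It is a syntactic object
which does not depend on the black boxes. -/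
abbrev OracleCircuit (V₁ V₂ W : Type) : Type := List (OracleGate V₁ V₂ W)

namespace OracleCircuit

variable {V₁ V₂ W : Type}

/-- The operator implemented by a circuit when the black boxes are `A` and `B`. -/
noncomputable def toOp [Fintype W] [DecidableEq W] (A : QOp V₁) (B : QOp V₂) :
    OracleCircuit V₁ V₂ W → QOp W
  | [] => 1
  | g :: c => OracleCircuit.toOp A B c * g.toOp A B

def elementaryCount (c : OracleCircuit V₁ V₂ W) : ℕ := c.countP OracleGate.isElementary

def queryACount (c : OracleCircuit V₁ V₂ W) : ℕ := c.countP OracleGate.isQueryA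

def queryBCount (c : OracleCircuit V₁ V₂ W) : ℕ := c.countP OracleGate.isQueryB

def queryBInvCount (c : OracleCircuit V₁ V₂ W) : ℕ := c.countP OracleGate.isQueryBInv

end OracleCircuit

/-! ### Ground state and gap -/

/-- `H` is Hermitian, its lowest eigenvalue is `E₀` and is nondegenerate, and its next eigenvalue
is `E₁`. -/
structure HasGroundLevels {n : ℕ} (H : QOp (Fin n)) (E₀ E₁ : ℝ) : Prop where
  hermitian : H.IsHermitian
  ground : IsLeast (spectrum ℝ H) E₀
  nondegenerate : Module.finrank ℂ (Module.End.eigenspace (Matrix.toLin' H) (E₀ : ℂ)) = 1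
  excited : IsLeast (spectrum ℝ H \ {E₀}) E₁

/-! Put δ = Δ/α_H and let h = (H - E₀)/α_H be the zero block of U_H. Under the hypotheses the
spectrum of h lies in {0} ∪ [δ, 1]. If P is an odd real polynomial with |P| < 1 on [-1, 1] that is
close to 3δ/(4x) on [δ, 1], then (4α_I/(3Δ)) P(h) is close to α_I (H - E₀)⁺: on the excited levels
by the choice of P, and exactly on the ground level because P(0) = 0. Multiplying by the zero block
of U_I costs one query and does not increase the error, which is at most (4α_I/(3Δ)) · (3/4) e^{-L}
= (α_I/Δ) e^{-L} ≤ ε.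

The polynomial (`exists_odd_approx_inv`) is P(x) = (3δ/4) B(x²)/x, where B vanishes at 0, maps [0,
1] to itself and is within e^{-L} of 1 on [δ², 1]. It is a composition: 1 - F_n/n², with F_n a Fejér
kernel and n of order 1/δ, rises from 0 to a constant threshold, and the tail of a binomial law with
N of order L sharpens that threshold. Markov's inequality keeps |P| below 1 near 0. The degree is at
most of order nN, hence of order L/δ.

The circuit uses the walk W = U_H† R U_H R, with R the reflection about the zero state of the
ancillas of U_H. For the row operator ⟨0| (`bra`) one has ⟨0| U_H (1 + W) = 2h ⟨0| and ⟨0| (1 + W†)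
= 2h ⟨0| U_H, so that ⟨0| U_H times a suitable Laurent polynomial of W equals P(h) ⟨0|
(`row_mul_aeval_liftOdd`); two-dimensional invariant subspaces are not needed. That Laurent
polynomial is bounded by 1 on the unit circle, so Fejér–Riesz provides a complementary polynomial,
and the pair peels off into single-qubit rotations and controlled walks (`exists_strip_layer`,
`QueryImpl.signalProcessing`). The only extra ancilla is the control qubit: the reflections take
O(m₁) gates with borrowed wires (`ElemImpl.controlledReflection`). -/

/-! ### Polynomial approximation of 1/x away from the origin -/

section PolynomialApproximation

open Polynomial

/-- The polynomials with `s * fejerPoly n s = sin² (n θ)` for `s = sin² θ`. -/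
noncomputable def fejerPoly : ℕ → ℝ[X]
  | 0 => 0
  | 1 => 1
  | (n + 2) => (C 2 - C 4 * X) * fejerPoly (n + 1) - fejerPoly n + C 2

theorem eval_fejerPoly_add_two (n : ℕ) (s : ℝ) :
    (fejerPoly (n + 2)).eval s
      = (2 - 4 * s) * (fejerPoly (n + 1)).eval s - (fejerPoly n).eval s + 2 := by
  simp [fejerPoly]

theorem sin_sq_mul_eval_fejerPoly (θ : ℝ) (n : ℕ) :
    Real.sin θ ^ 2 * (fejerPoly n).eval (Real.sin θ ^ 2) = Real.sin (n * θ) ^ 2 := by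
  induction n using Nat.twoStepInduction with
  | zero => simp [fejerPoly]
  | one => simp [fejerPoly]
  | more n h0 h1 =>
    have e2 : ((n + 2 : ℕ) : ℝ) * θ = (n + 1 : ℕ) * θ + θ := by push_cast; ring
    have e0 : (n : ℝ) * θ = (n + 1 : ℕ) * θ - θ := by push_cast; ring
    rw [e0] at h0
    rw [eval_fejerPoly_add_two, e2]
    set φ := ((n + 1 : ℕ) : ℝ) * θ
    have hs : Real.sin θ ^ 2 * ((2 - 4 * Real.sin θ ^ 2) * (fejerPoly (n + 1)).eval (Real.sin θ ^ 2)
        - (fejerPoly n).eval (Real.sin θ ^ 2) + 2)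
        = (2 - 4 * Real.sin θ ^ 2) * (Real.sin θ ^ 2 * (fejerPoly (n + 1)).eval (Real.sin θ ^ 2))
        - Real.sin θ ^ 2 * (fejerPoly n).eval (Real.sin θ ^ 2) + 2 * Real.sin θ ^ 2 := by ring
    rw [hs, h1, h0, Real.sin_add, Real.sin_sub]
    have c1 := Real.sin_sq_add_cos_sq θ
    have c2 := Real.sin_sq_add_cos_sq φ
    have c1' : Real.cos θ ^ 2 = 1 - Real.sin θ ^ 2 := by linarith
    have c2' : Real.cos φ ^ 2 = 1 - Real.sin φ ^ 2 := by linarith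
    ring_nf
    rw [c1', c2']
    ring

theorem abs_sin_natCast_mul_le (θ : ℝ) (n : ℕ) : |Real.sin (n * θ)| ≤ n * |Real.sin θ| := by
  induction n with
  | zero => simp
  | succ n ih =>
    have e : ((n + 1 : ℕ) : ℝ) * θ = n * θ + θ := by push_cast; ring
    rw [e, Real.sin_add]
    have a1 := Real.abs_cos_le_one θ
    have a2 := Real.abs_cos_le_one (n * θ)
    calc |Real.sin (n * θ) * Real.cos θ + Real.cos (n * θ) * Real.sin θ|
        ≤ |Real.sin (n * θ)| * |Real.cos θ| + |Real.cos (n * θ)| * |Real.sin θ| := by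
          rw [← abs_mul, ← abs_mul]; exact abs_add_le _ _
      _ ≤ |Real.sin (n * θ)| * 1 + 1 * |Real.sin θ| := by gcongr
      _ ≤ ((n + 1 : ℕ) : ℝ) * |Real.sin θ| := by push_cast; linarith

theorem eval_fejerPoly_zero (n : ℕ) : (fejerPoly n).eval 0 = (n : ℝ) ^ 2 := by
  induction n using Nat.twoStepInduction with
  | zero => simp [fejerPoly]
  | one => simp [fejerPoly]
  | more n h0 h1 =>
    rw [eval_fejerPoly_add_two, h0, h1]
    push_cast
    ring

theorem exists_sin_sq_eq {s : ℝ} (h0 : 0 ≤ s) (h1 : s ≤ 1) : ∃ θ : ℝ, Real.sin θ ^ 2 = s := by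
  refine ⟨Real.arcsin (Real.sqrt s), ?_⟩
  rw [Real.sin_arcsin (by linarith [Real.sqrt_nonneg s]) (Real.sqrt_le_one.mpr h1),
    Real.sq_sqrt h0]

theorem eval_fejerPoly_nonneg {s : ℝ} (h0 : 0 ≤ s) (h1 : s ≤ 1) (n : ℕ) :
    0 ≤ (fejerPoly n).eval s := by
  rcases h0.eq_or_lt with rfl | hs
  · rw [eval_fejerPoly_zero]; positivity
  obtain ⟨θ, rfl⟩ := exists_sin_sq_eq h0 h1
  have := sin_sq_mul_eval_fejerPoly θ n
  by_contra! h
  nlinarith [sq_nonneg (Real.sin (n * θ))]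

theorem eval_fejerPoly_le {s : ℝ} (h0 : 0 ≤ s) (h1 : s ≤ 1) (n : ℕ) :
    (fejerPoly n).eval s ≤ (n : ℝ) ^ 2 := by
  rcases h0.eq_or_lt with rfl | hs
  · rw [eval_fejerPoly_zero]
  obtain ⟨θ, rfl⟩ := exists_sin_sq_eq h0 h1
  have h := sin_sq_mul_eval_fejerPoly θ n
  have h2 := abs_sin_natCast_mul_le θ n
  have h3 : Real.sin (n * θ) ^ 2 ≤ (n : ℝ) ^ 2 * Real.sin θ ^ 2 := by
    rw [← sq_abs, ← sq_abs (Real.sin θ), ← mul_pow]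
    gcongr
  rw [← h, mul_comm] at h3
  exact le_of_mul_le_mul_right h3 hs

theorem mul_eval_fejerPoly_le_one {s : ℝ} (h0 : 0 ≤ s) (h1 : s ≤ 1) (n : ℕ) :
    s * (fejerPoly n).eval s ≤ 1 := by
  obtain ⟨θ, rfl⟩ := exists_sin_sq_eq h0 h1
  rw [sin_sq_mul_eval_fejerPoly θ n]
  exact Real.sin_sq_le_one _

/-- The recurrence says that the second difference of `fejerPoly` is 2 - 4s times the middle term,
and the middle term is at most (n+1)². Summing once bounds the first difference, summing twice the
value, hence the joint induction. -/
theorem le_eval_fejerPoly {s : ℝ} (h0 : 0 ≤ s) (h1 : s ≤ 1) (n : ℕ) :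
    (n : ℝ) ^ 2 - s * n ^ 2 * (n ^ 2 - 1) / 3 ≤ (fejerPoly n).eval s ∧
      2 * n + 1 - 2 / 3 * s * n * (n + 1) * (2 * n + 1)
        ≤ (fejerPoly (n + 1)).eval s - (fejerPoly n).eval s := by
  induction n with
  | zero => simp [fejerPoly]
  | succ n ih =>
    obtain ⟨i1, i2⟩ := ih
    have hu := eval_fejerPoly_le h0 h1 (n + 1)
    have hu' := mul_le_mul_of_nonneg_left hu h0
    refine ⟨?_, ?_⟩
    · push_cast
      nlinarith
    · rw [eval_fejerPoly_add_two]
      push_cast at hu' ⊢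
      nlinarith

theorem natDegree_fejerPoly_le (n : ℕ) : (fejerPoly n).natDegree ≤ n := by
  induction n using Nat.twoStepInduction with
  | zero => simp [fejerPoly]
  | one => simp [fejerPoly]
  | more n h0 h1 =>
    rw [fejerPoly]
    have a : (C 2 - C 4 * X : ℝ[X]).natDegree ≤ 1 := by compute_degree
    have b : ((C 2 - C 4 * X : ℝ[X]) * fejerPoly (n + 1)).natDegree ≤ n + 2 :=
      natDegree_mul_le.trans (by omega)
    have c : (fejerPoly n).natDegree ≤ n + 2 := h0.trans (by omega)
    exact natDegree_add_le_of_degree_le ((natDegree_sub_le _ _).trans (max_le b c)) (by simp)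

/-- The probability that a binomial variable with parameters `N`, `t` is at least `τ * N`. -/
noncomputable def binomialTail (τ : ℝ) (N : ℕ) : ℝ[X] :=
  ∑ k ∈ Finset.range (N + 1) with τ * N ≤ ((k : ℕ) : ℝ), C (N.choose k : ℝ) * (X ^ k * (1 - X) ^ (N - k))

theorem eval_binomialTail (τ : ℝ) (N : ℕ) (t : ℝ) :
    (binomialTail τ N).eval t = ∑ k ∈ Finset.range (N + 1) with τ * N ≤ ((k : ℕ) : ℝ),
      (N.choose k : ℝ) * (t ^ k * (1 - t) ^ (N - k)) := by
  simp [binomialTail, eval_finsetSum]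

theorem sum_choose_mul (N : ℕ) (a b : ℝ) :
    ∑ k ∈ Finset.range (N + 1), (N.choose k : ℝ) * (a ^ k * b ^ (N - k)) = (a + b) ^ N := by
  rw [add_pow]
  exact Finset.sum_congr rfl fun k _ => by ring

theorem sum_mul_choose_mul (N : ℕ) (t : ℝ) :
    ∑ k ∈ Finset.range (N + 1), (k : ℝ) * ((N.choose k : ℝ) * (t ^ k * (1 - t) ^ (N - k)))
      = N * t := by
  cases N with
  | zero => simp
  | succ N =>
    rw [Finset.sum_range_succ']
    have : ∀ k ∈ Finset.range (N + 1), ((k + 1 : ℕ) : ℝ) * (((N + 1).choose (k + 1) : ℝ)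
        * (t ^ (k + 1) * (1 - t) ^ (N + 1 - (k + 1))))
        = ((N + 1 : ℕ) : ℝ) * t * ((N.choose k : ℝ) * (t ^ k * (1 - t) ^ (N - k))) := by
      intro k _
      have h : ((N + 1 : ℕ) : ℝ) * (N.choose k : ℝ) = ((N + 1).choose (k + 1) : ℝ) * ((k + 1 : ℕ) : ℝ) := by
        exact_mod_cast Nat.add_one_mul_choose_eq N k
      rw [Nat.add_sub_add_right, pow_succ]
      linear_combination (-t * (t ^ k * (1 - t) ^ (N - k))) * h
    rw [Finset.sum_congr rfl this, ← Finset.mul_sum, sum_choose_mul]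
    simp

section
variable {τ t : ℝ} (N : ℕ)

theorem eval_binomialTail_nonneg (h0 : 0 ≤ t) (h1 : t ≤ 1) : 0 ≤ (binomialTail τ N).eval t := by
  rw [eval_binomialTail]
  have : 0 ≤ 1 - t := by linarith
  exact Finset.sum_nonneg fun k _ => by positivity

theorem eval_binomialTail_add (τ t : ℝ) (N : ℕ) :
    (binomialTail τ N).eval t + (∑ k ∈ Finset.range (N + 1) with ¬ τ * N ≤ ((k : ℕ) : ℝ),
      (N.choose k : ℝ) * (t ^ k * (1 - t) ^ (N - k))) = 1 := by
  rw [eval_binomialTail, Finset.sum_filter_add_sum_filter_not, sum_choose_mul]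
  simp

theorem eval_binomialTail_le_one (h0 : 0 ≤ t) (h1 : t ≤ 1) : (binomialTail τ N).eval t ≤ 1 := by
  have h := eval_binomialTail_add τ t N
  have : 0 ≤ 1 - t := by linarith
  have : 0 ≤ ∑ k ∈ Finset.range (N + 1) with ¬ τ * N ≤ ((k : ℕ) : ℝ),
      (N.choose k : ℝ) * (t ^ k * (1 - t) ^ (N - k)) :=
    Finset.sum_nonneg fun k _ => by positivity
  linarith

/-- Markov's inequality for a binomial variable, whose mean is N t. -/
theorem mul_eval_binomialTail_le (hN : 0 < N) (h0 : 0 ≤ t) (h1 : t ≤ 1) :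
    τ * (binomialTail τ N).eval t ≤ t := by
  have hN' : (0 : ℝ) < N := by exact_mod_cast hN
  have ht : 0 ≤ 1 - t := by linarith
  have : τ * N * (binomialTail τ N).eval t ≤ N * t := by
    rw [eval_binomialTail, ← sum_mul_choose_mul, Finset.mul_sum]
    calc _ ≤ ∑ k ∈ Finset.range (N + 1) with τ * N ≤ ((k : ℕ) : ℝ),
          (k : ℝ) * ((N.choose k : ℝ) * (t ^ k * (1 - t) ^ (N - k))) := by
          refine Finset.sum_le_sum fun k hk => ?_
          have := (Finset.mem_filter.mp hk).2
          gcongr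
      _ ≤ _ := Finset.sum_le_sum_of_subset_of_nonneg (Finset.filter_subset _ _)
          fun k _ _ => by positivity
  nlinarith

/-- Chernoff's bound for the lower tail: weight the terms with k < τN by e^{h(τN - k)} ≥ 1, extend
the sum to all k and use the generating function. -/
theorem one_sub_eval_binomialTail_le {h : ℝ} (hh : 0 ≤ h) (h0 : 0 ≤ t) (h1 : t ≤ 1)
    (hτ : τ + 2 * h ≤ t) : 1 - (binomialTail τ N).eval t ≤ Real.exp (-(N * h ^ 2)) := by
  have e := eval_binomialTail_add τ t N
  have ht : 0 ≤ 1 - t := by linarith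
  have : 1 - (binomialTail τ N).eval t = ∑ k ∈ Finset.range (N + 1) with ¬ τ * N ≤ ((k : ℕ) : ℝ),
      (N.choose k : ℝ) * (t ^ k * (1 - t) ^ (N - k)) := by linarith
  rw [this]
  calc _ ≤ ∑ k ∈ Finset.range (N + 1) with ¬ τ * N ≤ ((k : ℕ) : ℝ), Real.exp (h * (τ * N)) *
          ((N.choose k : ℝ) * ((Real.exp (-h) * t) ^ k * (1 - t) ^ (N - k))) := by
        refine Finset.sum_le_sum fun k hk => ?_
        have hk' := (Finset.mem_filter.mp hk).2
        have : 1 ≤ Real.exp (h * (τ * N)) * Real.exp (-h) ^ k := by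
          rw [← Real.exp_nat_mul, ← Real.exp_add]
          apply Real.one_le_exp
          nlinarith
        have p : 0 ≤ (N.choose k : ℝ) * (t ^ k * (1 - t) ^ (N - k)) := by positivity
        calc _ ≤ (Real.exp (h * (τ * N)) * Real.exp (-h) ^ k) *
              ((N.choose k : ℝ) * (t ^ k * (1 - t) ^ (N - k))) := le_mul_of_one_le_left p this
          _ = _ := by rw [mul_pow]; ring
    _ ≤ ∑ k ∈ Finset.range (N + 1), Real.exp (h * (τ * N)) *
          ((N.choose k : ℝ) * ((Real.exp (-h) * t) ^ k * (1 - t) ^ (N - k))) :=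
        Finset.sum_le_sum_of_subset_of_nonneg (Finset.filter_subset _ _)
          fun k _ _ => by positivity
    _ = Real.exp (h * (τ * N)) * (Real.exp (-h) * t + (1 - t)) ^ N := by
        rw [← Finset.mul_sum, sum_choose_mul]
    _ ≤ Real.exp (h * (τ * N)) * (Real.exp (-(t * (h - h ^ 2 / 2)))) ^ N := by
        -- This follows from e^h ≥ 1 + h + h²/2 and (1 + h + h²/2)(1 - h + h²/2) = 1 + h⁴/4 ≥ 1.
        have q : Real.exp (-h) ≤ 1 - h + h ^ 2 / 2 := by
          have a := Real.quadratic_le_exp_of_nonneg hh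
          have b : Real.exp (-h) * Real.exp h = 1 := by rw [← Real.exp_add]; simp
          have c := Real.exp_pos (-h)
          have d : Real.exp (-h) * (1 + h + h ^ 2 / 2) ≤ 1 := by nlinarith
          by_contra! hc
          nlinarith [mul_lt_mul_of_pos_right hc (by positivity : 0 < 1 + h + h ^ 2 / 2),
            sq_nonneg (h ^ 2)]
        have r : Real.exp (-h) * t + (1 - t) ≤ Real.exp (-(t * (h - h ^ 2 / 2))) := by
          have := Real.add_one_le_exp (-(t * (h - h ^ 2 / 2)))
          nlinarith
        gcongr
    _ ≤ Real.exp (-(N * h ^ 2)) := by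
        rw [← Real.exp_nat_mul, ← Real.exp_add]
        apply Real.exp_le_exp.mpr
        have hN : (0 : ℝ) ≤ N := Nat.cast_nonneg N
        have : h * τ - t * (h - h ^ 2 / 2) ≤ - h ^ 2 := by nlinarith [sq_nonneg h]
        nlinarith

end

theorem natDegree_binomialTail_le (τ : ℝ) (N : ℕ) : (binomialTail τ N).natDegree ≤ N := by
  refine natDegree_sum_le_of_forall_le _ _ fun k hk => ?_
  have hk' := Finset.mem_range.mp (Finset.mem_filter.mp hk).1
  refine (natDegree_C_mul_le _ _).trans (natDegree_mul_le.trans ?_)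
  have a : ((1 - X : ℝ[X]) ^ (N - k)).natDegree ≤ N - k := by
    have : (1 - X : ℝ[X]).natDegree ≤ 1 := by compute_degree
    exact natDegree_pow_le.trans (by nlinarith)
  rw [natDegree_X_pow]
  omega

theorem eval_zero_binomialTail {τ : ℝ} (hτ : 0 < τ) {N : ℕ} (hN : 0 < N) :
    (binomialTail τ N).eval 0 = 0 := by
  rw [eval_binomialTail]
  refine Finset.sum_eq_zero fun k hk => ?_
  have hk' := (Finset.mem_filter.mp hk).2
  have : k ≠ 0 := by
    rintro rfl
    have : (0 : ℝ) < N := by exact_mod_cast hN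
    have := mul_pos hτ this
    simp at hk'
    linarith
  simp [this]

/-- An odd polynomial `x G(x²)` of degree `O(L/δ)`, strictly bounded by `1` on `[-1, 1]`, which
approximates `3δ/(4x)` up to `e^{-L}` on `[δ, 1]`. -/
theorem exists_odd_approx_inv {δ L : ℝ} (h0 : 0 < δ) (h1 : δ ≤ 1) (hL : 1 ≤ L) :
    ∃ G : ℝ[X], (G.natDegree : ℝ) ≤ 30000 * (L / δ) ∧
      (∀ x : ℝ, |x| ≤ 1 → |x * G.eval (x ^ 2)| < 1) ∧
      (∀ x : ℝ, δ ≤ x → x ≤ 1 →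
        |x * G.eval (x ^ 2) - 3 / 4 * δ / x| ≤ 3 / 4 * Real.exp (-L)) := by
  -- The kernel index n makes w = nδ lie in [5/4, 5/4 + δ). The factor 10000 in N is h⁻² for the
  -- Chernoff gap h = 1/100.
  obtain ⟨n, hn⟩ : ∃ n : ℕ, n = ⌈5 / (4 * δ)⌉₊ := ⟨_, rfl⟩
  obtain ⟨N, hN⟩ : ∃ N : ℕ, N = ⌈L * 10000⌉₊ := ⟨_, rfl⟩
  have hn1 : 5 / 4 ≤ n * δ := by
    have := Nat.le_ceil (5 / (4 * δ))
    rw [← hn, div_le_iff₀ (by positivity)] at this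
    linarith
  have hn2 : n * δ < 5 / 4 + δ := by
    have := Nat.ceil_lt_add_one (a := 5 / (4 * δ)) (by positivity)
    rw [← hn] at this
    have h := mul_lt_mul_of_pos_right this h0
    have e : (5 / (4 * δ) + 1) * δ = 5 / 4 + δ := by field_simp
    linarith
  have hNL : L * 10000 ≤ N := hN ▸ Nat.le_ceil _
  have hNu : (N : ℝ) < L * 10000 + 1 := hN ▸ Nat.ceil_lt_add_one (by positivity)
  have hN0 : 0 < N := by
    have : (0 : ℝ) < N := by linarith
    exact_mod_cast this
  have hnpos : (0 : ℝ) < n := by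
    by_contra! h
    nlinarith
  set w : ℝ := n * δ with hw
  have hwpos : 0 < w := by positivity
  -- On [δ², 1] the polynomial `S` below is at least 1 - 1/w², so τ leaves the gap 2h = 1/50.
  set τ : ℝ := 1 - 1 / w ^ 2 - 1 / 50 with hτ
  -- This is the inequality that keeps the final polynomial below 1 near the origin. Since v = w -
  -- 5/4 lies in [0, δ), one has w² - δ² ≤ w² - v², and what remains is a one-variable inequality
  -- for v in [0, 1].
  have hτlow : 3 / 16 * (w ^ 2 - δ ^ 2) < τ := by
    have hv : w ^ 2 - δ ^ 2 ≤ 25 / 16 + 5 / 2 * (w - 5 / 4) := by nlinarith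
    have hv1 : w - 5 / 4 ≤ 1 := by linarith
    have : 1 / w ^ 2 < 1 - 1 / 50 - 3 / 16 * (25 / 16 + 5 / 2 * (w - 5 / 4)) := by
      rw [div_lt_iff₀ (by positivity)]
      obtain ⟨v, hv'⟩ : ∃ v, v = w - 5 / 4 := ⟨_, rfl⟩
      have hw' : w = 5 / 4 + v := by linarith
      have v0 : 0 ≤ v := by linarith
      have v1 : 0 ≤ 1 - v := by linarith
      rw [hw']
      nlinarith [mul_nonneg v0 v1, mul_nonneg (mul_nonneg v0 v1) v0]
    linarith
  have hτpos : 0 < τ := by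
    have : δ < w := by linarith
    nlinarith
  set S : ℝ[X] := 1 - C (1 / (n : ℝ) ^ 2) * fejerPoly n with hS
  have hSe : ∀ s, S.eval s = 1 - (fejerPoly n).eval s / n ^ 2 := by
    intro s; simp [hS]; ring
  have hS0 : ∀ s, 0 ≤ s → s ≤ 1 → 0 ≤ S.eval s := by
    intro s a b
    rw [hSe, sub_nonneg, div_le_one (by positivity)]
    exact eval_fejerPoly_le a b n
  have hS1 : ∀ s, 0 ≤ s → s ≤ 1 → S.eval s ≤ 1 := by
    intro s a b
    rw [hSe]
    have := eval_fejerPoly_nonneg a b n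
    have : 0 ≤ (fejerPoly n).eval s / n ^ 2 := by positivity
    linarith
  have hSup : ∀ s, 0 ≤ s → s ≤ 1 → S.eval s ≤ (n ^ 2 - 1) / 3 * s := by
    intro s a b
    rw [hSe]
    have := (le_eval_fejerPoly a b n).1
    have : 1 - s * (n ^ 2 - 1) / 3 ≤ (fejerPoly n).eval s / n ^ 2 := by
      rw [le_div_iff₀ (by positivity)]
      linarith
    linarith
  have hSlow : ∀ s, δ ^ 2 ≤ s → s ≤ 1 → τ + 2 * (1 / 100) ≤ S.eval s := by
    intro s a b
    have hs : 0 < s := lt_of_lt_of_le (by positivity) a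
    rw [hSe, hτ]
    have h := mul_eval_fejerPoly_le_one hs.le b n
    have : (fejerPoly n).eval s / n ^ 2 ≤ 1 / w ^ 2 := by
      rw [hw, div_le_div_iff₀ (by positivity) (by positivity), mul_pow]
      have := eval_fejerPoly_nonneg hs.le b n
      have : δ ^ 2 * (fejerPoly n).eval s ≤ s * (fejerPoly n).eval s := by gcongr
      nlinarith [sq_nonneg (n : ℝ)]
    linarith
  set B : ℝ[X] := (binomialTail τ N).comp S with hB
  have hBe : ∀ s, B.eval s = (binomialTail τ N).eval (S.eval s) := fun s => by simp [hB]
  -- B(0) = 0 because S(0) = 0 and the threshold τN is positive; hence B(s)/s is a polynomial and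
  -- (3δ/4) B(x²)/x is odd.
  have hBX : X * B.divX = B := by
    have h := divX_mul_X_add B
    have : B.coeff 0 = 0 := by
      rw [coeff_zero_eq_eval_zero, hBe, hSe, eval_fejerPoly_zero, div_self (by positivity), sub_self,
        eval_zero_binomialTail hτpos hN0]
    rw [this, C_0, add_zero, mul_comm] at h
    exact h
  have hG : ∀ s, s * (C (3 / 4 * δ) * B.divX).eval s = 3 / 4 * δ * B.eval s := by
    intro s
    conv_rhs => rw [← hBX]
    simp
    ring
  have hGx : ∀ x, x ≠ 0 → x * (C (3 / 4 * δ) * B.divX).eval (x ^ 2)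
      = 3 / 4 * δ * B.eval (x ^ 2) / x := by
    intro x hx
    rw [eq_div_iff hx, ← hG]
    ring
  refine ⟨C (3 / 4 * δ) * B.divX, ?_, ?_, ?_⟩
  · have d1 : (C (3 / 4 * δ) * B.divX).natDegree ≤ N * n := by
      refine (natDegree_C_mul_le _ _).trans ?_
      rw [natDegree_divX_eq_natDegree_tsub_one]
      have : S.natDegree ≤ n := by
        exact (natDegree_sub_le _ _).trans (max_le (by simp) ((natDegree_C_mul_le _ _).trans
          (natDegree_fejerPoly_le n)))
      calc B.natDegree - 1 ≤ B.natDegree := Nat.sub_le _ _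
        _ ≤ (binomialTail τ N).natDegree * S.natDegree := natDegree_comp_le
        _ ≤ N * n := Nat.mul_le_mul (natDegree_binomialTail_le τ N) this
    have d2 : ((C (3 / 4 * δ) * B.divX).natDegree : ℝ) ≤ N * n := by exact_mod_cast d1
    refine d2.trans ?_
    rw [← mul_div_assoc, le_div_iff₀ h0]
    have a : (N : ℝ) ≤ 10001 * L := by linarith
    have b : (n : ℝ) * δ ≤ 9 / 4 := by linarith
    calc (N : ℝ) * n * δ = N * (n * δ) := by ring
      _ ≤ (10001 * L) * (9 / 4) := by gcongr
      _ ≤ 30000 * L := by linarith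
  · intro x hx
    rcases eq_or_ne x 0 with rfl | hx0
    · simp
    have hs1 : x ^ 2 ≤ 1 := by
      rw [← sq_abs]; exact pow_le_one₀ (abs_nonneg x) hx
    have hs0 : 0 ≤ x ^ 2 := sq_nonneg x
    have hax : 0 < |x| := abs_pos.mpr hx0
    rw [hGx x hx0, abs_div, div_lt_one hax, hBe]
    have b0 := eval_binomialTail_nonneg (τ := τ) N (hS0 _ hs0 hs1) (hS1 _ hs0 hs1)
    have b1 := eval_binomialTail_le_one (τ := τ) N (hS0 _ hs0 hs1) (hS1 _ hs0 hs1)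
    have b2 := mul_eval_binomialTail_le (τ := τ) N hN0 (hS0 _ hs0 hs1) (hS1 _ hs0 hs1)
    rw [abs_of_nonneg (by positivity)]
    -- Beyond 3δ/4 the bound B ≤ 1 is enough. Below it, Markov's inequality and S(s) ≤ (n² - 1)s/3
    -- bound |P(x)| by (3/16)(w² - δ²)/τ, which is less than 1 by `hτlow`.
    by_cases hc : 3 / 4 * δ < |x|
    · nlinarith
    push Not at hc
    have b3 := hSup _ hs0 hs1
    set b := (binomialTail τ N).eval (S.eval (x ^ 2))
    have b4 : τ * b ≤ (n ^ 2 - 1) / 3 * |x| ^ 2 := by rw [sq_abs]; linarith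
    have hn1' : 0 ≤ (n : ℝ) ^ 2 - 1 := by
      have : (1 : ℝ) ≤ n := by
        have : 0 < n := by exact_mod_cast hnpos
        exact_mod_cast this
      nlinarith
    have b5 : (n ^ 2 - 1) / 3 * |x| ^ 2 ≤ (n ^ 2 - 1) / 3 * (3 / 4 * δ * |x|) := by
      have : |x| ^ 2 ≤ 3 / 4 * δ * |x| := by nlinarith
      gcongr
    have b6 : τ * (3 / 4 * δ * b) < τ * |x| := by
      have : 3 / 4 * δ * ((n ^ 2 - 1) / 3 * (3 / 4 * δ * |x|)) = 3 / 16 * (w ^ 2 - δ ^ 2) * |x| := by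
        rw [hw]; ring
      have c : 3 / 16 * (w ^ 2 - δ ^ 2) * |x| < τ * |x| := by gcongr
      have d : 3 / 4 * δ * (τ * b) ≤ 3 / 4 * δ * ((n ^ 2 - 1) / 3 * (3 / 4 * δ * |x|)) := by
        have := b4.trans b5
        gcongr
      linarith
    exact lt_of_mul_lt_mul_left b6 hτpos.le
  · intro x hx hx1
    have hx0 : 0 < x := by linarith
    have hs1 : x ^ 2 ≤ 1 := pow_le_one₀ hx0.le hx1
    have hs0 : 0 ≤ x ^ 2 := sq_nonneg x
    have b1 := eval_binomialTail_le_one (τ := τ) N (hS0 _ hs0 hs1) (hS1 _ hs0 hs1)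
    have b2 := one_sub_eval_binomialTail_le (τ := τ) N (by norm_num : (0 : ℝ) ≤ 1 / 100)
      (hS0 _ hs0 hs1) (hS1 _ hs0 hs1) (hSlow _ (by gcongr) hs1)
    rw [hGx x hx0.ne', hBe]
    set b := (binomialTail τ N).eval (S.eval (x ^ 2))
    have e : 3 / 4 * δ * b / x - 3 / 4 * δ / x = -(3 / 4 * (δ / x) * (1 - b)) := by
      field_simp
      ring
    have hb : 0 ≤ 1 - b := by linarith
    rw [e, abs_neg, abs_of_nonneg (by positivity)]
    have : δ / x ≤ 1 := (div_le_one hx0).mpr hx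
    have hexp : Real.exp (-(N * (1 / 100 : ℝ) ^ 2)) ≤ Real.exp (-L) := by
      apply Real.exp_le_exp.mpr
      linarith
    calc 3 / 4 * (δ / x) * (1 - b) ≤ 3 / 4 * 1 * Real.exp (-L) := by
          gcongr
          exact b2.trans hexp
      _ = _ := by ring

end PolynomialApproximation

/-! ### Fejér–Riesz factorization and complementary polynomials on the circle -/

section FejerRiesz

open Polynomial ComplexConjugate

/-- The polynomial which equals `z ^ d * conj (f z)` on the unit circle. -/
noncomputable def circRev (d : ℕ) (f : ℂ[X]) : ℂ[X] := reflect d (f.map (starRingEnd ℂ))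

theorem coeff_circRev_of_le {d i : ℕ} (f : ℂ[X]) (h : i ≤ d) :
    (circRev d f).coeff i = conj (f.coeff (d - i)) := by
  rw [circRev, coeff_reflect, revAt_le h, coeff_map]

theorem eval_circRev {d : ℕ} {f : ℂ[X]} (hf : f.natDegree ≤ d) {z : ℂ} (hz : z ≠ 0) :
    (circRev d f).eval z = z ^ d * conj (f.eval (conj z)⁻¹) := by
  let _ : Invertible z⁻¹ := invertibleOfNonzero (inv_ne_zero hz)
  have h := eval₂_reflect_mul_pow (RingHom.id ℂ) z⁻¹ d (f.map (starRingEnd ℂ))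
    (natDegree_map_le.trans hf)
  rw [invOf_eq_inv, inv_inv] at h
  have e : eval₂ (RingHom.id ℂ) z⁻¹ (f.map (starRingEnd ℂ)) = conj (f.eval (conj z)⁻¹) := by
    rw [← map_inv₀, ← Polynomial.eval, eval_map, ← eval₂_at_apply, Complex.conj_conj]
  rw [e] at h
  rw [← h, circRev, Polynomial.eval, inv_pow, mul_comm, mul_assoc, inv_mul_cancel₀ (pow_ne_zero d hz),
    mul_one]

theorem inv_conj_of_norm_eq_one {z : ℂ} (hz : ‖z‖ = 1) : (conj z)⁻¹ = z := by
  rw [← Complex.inv_eq_conj hz, inv_inv]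

theorem infinite_unit_circle : {z : ℂ | ‖z‖ = 1}.Infinite := by
  have h : IsPreconnected (Metric.sphere (0 : ℂ) 1) :=
    isPreconnected_sphere (by rw [Complex.rank_real_complex]; norm_num) 0 1
  have h2 : (Metric.sphere (0 : ℂ) 1).Nontrivial :=
    ⟨1, by simp, -1, by simp, by norm_num⟩
  have := h.infinite_of_nontrivial h2
  convert this using 1
  ext z
  simp

theorem eq_of_eval_eq_on_circle {p q : ℂ[X]} (h : ∀ z : ℂ, ‖z‖ = 1 → p.eval z = q.eval z) :
    p = q :=
  eq_of_infinite_eval_eq p q (infinite_unit_circle.mono h)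

theorem mul_conj_eq_one_of_norm_eq_one {z : ℂ} (hz : ‖z‖ = 1) : z * conj z = 1 := by
  rw [Complex.mul_conj, Complex.normSq_eq_norm_sq, hz]; norm_num

/-- Fejér–Riesz factorization of a strictly positive trigonometric polynomial `z ^ (-d) * p`. -/
theorem exists_fejerRiesz_factor (d : ℕ) : ∀ p : ℂ[X], p.natDegree ≤ 2 * d →
    (∀ z : ℂ, ‖z‖ = 1 → ∃ c : ℝ, 0 < c ∧ p.eval z = z ^ d * c) →
    ∃ q : ℂ[X], q.natDegree ≤ d ∧ ∀ z : ℂ, ‖z‖ = 1 → p.eval z = z ^ d * (‖q.eval z‖ ^ 2 : ℝ) := by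
  induction d with
  | zero =>
    intro p hp hpos
    obtain ⟨a, rfl⟩ := natDegree_eq_zero.mp (Nat.le_zero.mp hp)
    obtain ⟨c, hc, h⟩ := hpos 1 (by simp)
    refine ⟨C (Real.sqrt c : ℂ), by simp, fun z _ => ?_⟩
    simp only [eval_C, pow_zero, one_mul] at h ⊢
    rw [h, Complex.norm_real, Real.norm_eq_abs, sq_abs, Real.sq_sqrt hc.le]
  | succ d ih =>
    intro p hp hpos
    -- On the circle p equals z^(d+1) times a real number, so p is self-reciprocal: its roots are
    -- symmetric under z ↦ 1/conj z, and its extreme coefficients are conjugate.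
    have hself : circRev (2 * (d + 1)) p = p := by
      refine eq_of_eval_eq_on_circle fun z hz => ?_
      have hz0 : z ≠ 0 := by rintro rfl; simp at hz
      obtain ⟨c, hc, h⟩ := hpos z hz
      rw [eval_circRev hp hz0, inv_conj_of_norm_eq_one hz, h, map_mul, map_pow, Complex.conj_ofReal,
        two_mul, pow_add]
      calc z ^ (d + 1) * z ^ (d + 1) * (conj z ^ (d + 1) * c)
          = z ^ (d + 1) * (z * conj z) ^ (d + 1) * c := by rw [mul_pow]; ring
        _ = _ := by rw [mul_conj_eq_one_of_norm_eq_one hz, one_pow, mul_one]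
    have htop : p.coeff (2 * (d + 1)) = conj (p.coeff 0) := by
      conv_lhs => rw [← hself]
      rw [coeff_circRev_of_le _ le_rfl, Nat.sub_self]
    -- If the constant coefficient vanishes, so does the top one, and dividing by X lowers d by one.
    -- Otherwise a root r off the circle is removed together with its distinct mirror image 1/conj
    -- r.
    by_cases h0 : p.coeff 0 = 0
    · have hX : X * p.divX = p := by
        have h := divX_mul_X_add p
        rw [h0, C_0, add_zero, mul_comm] at h
        exact h
      rw [h0, map_zero] at htop
      have hdeg : p.natDegree ≤ 2 * (d + 1) - 1 := natDegree_le_pred hp htop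
      have hdiv : ∀ z : ℂ, z * p.divX.eval z = p.eval z := fun z => by
        conv_rhs => rw [← hX]
        simp
      obtain ⟨q, hq, hqe⟩ := ih p.divX (by rw [natDegree_divX_eq_natDegree_tsub_one]; omega)
        (fun z hz => by
          have hz0 : z ≠ 0 := by rintro rfl; simp at hz
          obtain ⟨c, hc, h⟩ := hpos z hz
          refine ⟨c, hc, mul_left_cancel₀ hz0 ?_⟩
          rw [hdiv, h, pow_succ]; ring)
      refine ⟨q, hq.trans (Nat.le_succ d), fun z hz => ?_⟩
      rw [← hdiv, hqe z hz, pow_succ]; ring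
    · have hdegne : p.degree ≠ 0 := by
        intro h
        have := natDegree_eq_zero_iff_degree_le_zero.mpr h.le
        have h2 : p.coeff (2 * (d + 1)) = 0 := coeff_eq_zero_of_natDegree_lt (by omega)
        rw [h2] at htop
        exact h0 ((map_eq_zero _).mp htop.symm)
      obtain ⟨r, hr⟩ := IsAlgClosed.exists_root p hdegne
      have hr0 : r ≠ 0 := by
        rintro rfl
        exact h0 (by rw [coeff_zero_eq_eval_zero]; exact hr)
      have hr1 : ‖r‖ ≠ 1 := by
        intro h
        obtain ⟨c, hc, he⟩ := hpos r h
        rw [hr.eq_zero] at he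
        have : r ^ (d + 1) * (c : ℂ) ≠ 0 :=
          mul_ne_zero (pow_ne_zero _ hr0) (Complex.ofReal_ne_zero.mpr hc.ne')
        exact this he.symm
      have hcr0 : conj r ≠ 0 := (_root_.map_ne_zero _).mpr hr0
      have hr' : p.eval (conj r)⁻¹ = 0 := by
        have h := eval_circRev hp hr0
        rw [hself, hr.eq_zero] at h
        have := (mul_eq_zero.mp h.symm).resolve_left (pow_ne_zero _ hr0)
        exact (map_eq_zero _).mp this
      have hne : (conj r)⁻¹ - r ≠ 0 := by
        intro h
        have h1 : r * conj r = 1 := by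
          nth_rw 1 [← sub_eq_zero.mp h]
          exact inv_mul_cancel₀ hcr0
        rw [Complex.mul_conj, Complex.normSq_eq_norm_sq] at h1
        have h2 : ‖r‖ ^ 2 = 1 := by exact_mod_cast h1
        exact hr1 ((pow_eq_one_iff_of_nonneg (norm_nonneg r) two_ne_zero).mp h2)
      obtain ⟨p1, hp1⟩ := dvd_iff_isRoot.mpr hr
      have hp1r : p1.IsRoot (conj r)⁻¹ := by
        rw [hp1] at hr'
        simp only [eval_mul, eval_sub, eval_X, eval_C] at hr'
        exact (mul_eq_zero.mp hr').resolve_left hne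
      obtain ⟨p2, hp2⟩ := dvd_iff_isRoot.mpr hp1r
      have hp0 : p ≠ 0 := by rintro rfl; simp at h0
      have hp1' : p1 ≠ 0 := by rintro rfl; simp at hp1; exact hp0 hp1
      have hp2' : p2 ≠ 0 := by rintro rfl; simp at hp2; exact hp1' hp2
      have hdeg2 : p2.natDegree + 2 = p.natDegree := by
        rw [hp1, natDegree_mul (X_sub_C_ne_zero _) hp1', hp2,
          natDegree_mul (X_sub_C_ne_zero _) hp2', natDegree_X_sub_C, natDegree_X_sub_C]
        ring
      -- On the circle 1 - z conj r = z conj(z - r), so the pair of roots contributes z|z - r|² up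
      -- to the constant -1/conj r, which is left with the quotient.
      have key : ∀ z : ℂ, ‖z‖ = 1 → p.eval z
          = z * (‖z - r‖ ^ 2 : ℝ) * (C (-(conj r)⁻¹) * p2).eval z := by
        intro z hz
        have hz1 := mul_conj_eq_one_of_norm_eq_one hz
        have hn : ((‖z - r‖ ^ 2 : ℝ) : ℂ) = (z - r) * (conj z - conj r) := by
          rw [← map_sub, Complex.mul_conj, Complex.normSq_eq_norm_sq]
        rw [hn, hp1, hp2]
        simp only [eval_mul, eval_sub, eval_X, eval_C]
        have : z - (conj r)⁻¹ = -(conj r)⁻¹ * (1 - z * conj r) := by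
          field_simp
          ring
        rw [this, ← hz1]
        ring
      have hzr : ∀ z : ℂ, ‖z‖ = 1 → 0 < ‖z - r‖ ^ 2 := by
        intro z hz
        have : z - r ≠ 0 := by
          intro h
          rw [sub_eq_zero.mp h] at hz
          exact hr1 hz
        positivity
      obtain ⟨q, hq, hqe⟩ := ih (C (-(conj r)⁻¹) * p2)
        ((natDegree_C_mul_le _ _).trans (by omega)) (fun z hz => by
          have hz0 : z ≠ 0 := by rintro rfl; simp at hz
          obtain ⟨c, hc, h⟩ := hpos z hz
          have hpz := hzr z hz
          refine ⟨c / ‖z - r‖ ^ 2, by positivity, ?_⟩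
          have hpz' : ((‖z - r‖ ^ 2 : ℝ) : ℂ) ≠ 0 := Complex.ofReal_ne_zero.mpr hpz.ne'
          refine mul_left_cancel₀ (mul_ne_zero hz0 hpz') ?_
          rw [← key z hz, h, Complex.ofReal_div, pow_succ]
          field_simp)
      refine ⟨(X - C r) * q, natDegree_mul_le.trans (by rw [natDegree_X_sub_C]; omega),
        fun z hz => ?_⟩
      rw [key z hz, hqe z hz, eval_mul, norm_mul, mul_pow, eval_sub, eval_X, eval_C,
        Complex.ofReal_mul, pow_succ]
      ring

theorem natDegree_circRev_le (d : ℕ) (f : ℂ[X]) (hf : f.natDegree ≤ d) :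
    (circRev d f).natDegree ≤ d := by
  refine natDegree_le_iff_coeff_eq_zero.mpr fun i hi => ?_
  rw [circRev, coeff_reflect, revAt_eq_self_of_lt hi, coeff_map,
    coeff_eq_zero_of_natDegree_lt (hf.trans_lt hi), map_zero]

theorem eval_mul_circRev {d : ℕ} {f : ℂ[X]} (hf : f.natDegree ≤ d) {z : ℂ} (hz : ‖z‖ = 1) :
    (f * circRev d f).eval z = z ^ d * (‖f.eval z‖ ^ 2 : ℝ) := by
  have hz0 : z ≠ 0 := by rintro rfl; simp at hz
  rw [eval_mul, eval_circRev hf hz0, inv_conj_of_norm_eq_one hz, ← Complex.normSq_eq_norm_sq,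
    ← Complex.mul_conj]
  ring

/-- A polynomial bounded by `1` on the unit circle has a complementary polynomial. -/
theorem exists_complementary_polynomial {d : ℕ} {f : ℂ[X]} (hf : f.natDegree ≤ d)
    (h1 : ∀ z : ℂ, ‖z‖ = 1 → ‖f.eval z‖ < 1) :
    ∃ g : ℂ[X], g.natDegree ≤ d ∧ ∀ z : ℂ, ‖z‖ = 1 → ‖f.eval z‖ ^ 2 + ‖g.eval z‖ ^ 2 = 1 := by
  -- This polynomial represents 1 - |f|², and the strict bound on f supplies the strict positivity
  -- required for the factorization.
  have he : ∀ z : ℂ, ‖z‖ = 1 → (X ^ d - f * circRev d f).eval z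
      = z ^ d * ((1 - ‖f.eval z‖ ^ 2 : ℝ) : ℂ) := by
    intro z hz
    rw [eval_sub, eval_mul_circRev hf hz]
    push_cast
    simp
    ring
  obtain ⟨g, hg, hge⟩ := exists_fejerRiesz_factor d (X ^ d - f * circRev d f)
    ((natDegree_sub_le _ _).trans (max_le (by rw [natDegree_X_pow]; omega)
      (natDegree_mul_le.trans (by have := natDegree_circRev_le d f hf; omega))))
    (fun z hz => ⟨1 - ‖f.eval z‖ ^ 2, by have := h1 z hz; have := norm_nonneg (f.eval z); nlinarith,
      he z hz⟩)
  refine ⟨g, hg, fun z hz => ?_⟩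
  have hz0 : z ≠ 0 := by rintro rfl; simp at hz
  have h := (he z hz).symm.trans (hge z hz)
  have := mul_left_cancel₀ (pow_ne_zero _ hz0) h
  have : 1 - ‖f.eval z‖ ^ 2 = ‖g.eval z‖ ^ 2 := by exact_mod_cast this
  linarith

/-- The vector (a, b) must be parallel to v and orthogonal to w. Normalize v if it is nonzero;
otherwise any unit vector orthogonal to w will do. -/
theorem exists_unit_vector_of_orthogonal {v₁ v₂ w₁ w₂ : ℂ} (h : v₁ * conj w₁ + v₂ * conj w₂ = 0) :
    ∃ a b : ℂ, a * conj a + b * conj b = 1 ∧ v₁ * b = v₂ * a ∧ conj a * w₁ + conj b * w₂ = 0 := by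
  have normalize : ∀ a b : ℂ, (a ≠ 0 ∨ b ≠ 0) → v₁ * b = v₂ * a → conj a * w₁ + conj b * w₂ = 0 →
      ∃ a b : ℂ, a * conj a + b * conj b = 1 ∧ v₁ * b = v₂ * a ∧ conj a * w₁ + conj b * w₂ = 0 := by
    intro a b hab h1 h2
    have hpos : 0 < Complex.normSq a + Complex.normSq b := by
      rcases hab with h | h
      · have := Complex.normSq_pos.mpr h; have := Complex.normSq_nonneg b; linarith
      · have := Complex.normSq_pos.mpr h; have := Complex.normSq_nonneg a; linarith
    set s : ℝ := Real.sqrt (Complex.normSq a + Complex.normSq b) with hs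
    have hs0 : (s : ℂ) ≠ 0 := Complex.ofReal_ne_zero.mpr (Real.sqrt_pos.mpr hpos).ne'
    have hs2 : (s : ℂ) * s = a * conj a + b * conj b := by
      rw [Complex.mul_conj, Complex.mul_conj, ← Complex.ofReal_add, ← Complex.ofReal_mul,
        Real.mul_self_sqrt hpos.le]
    refine ⟨a / s, b / s, ?_, ?_, ?_⟩
    · rw [map_div₀, map_div₀, Complex.conj_ofReal]
      field_simp
      rw [sq, hs2]
    · rw [mul_div_assoc', mul_div_assoc', h1]
    · rw [map_div₀, map_div₀, Complex.conj_ofReal, div_mul_eq_mul_div, div_mul_eq_mul_div, ← add_div,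
        h2, zero_div]
  by_cases hv : v₁ ≠ 0 ∨ v₂ ≠ 0
  · refine normalize v₁ v₂ hv (mul_comm _ _) ?_
    have := congrArg conj h
    simpa using this
  · push Not at hv
    by_cases hw : w₁ ≠ 0 ∨ w₂ ≠ 0
    · refine normalize (-conj w₂) (conj w₁) ?_ (by simp [hv.1, hv.2]) (by simp; ring)
      rcases hw with hw | hw
      · exact Or.inr ((_root_.map_ne_zero _).mpr hw)
      · exact Or.inl (neg_ne_zero.mpr ((_root_.map_ne_zero _).mpr hw))
    · push Not at hw
      exact ⟨1, 0, by simp, by simp [hv.1, hv.2], by simp [hw.1]⟩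

/-- One step of the reduction of a pair of complementary polynomials to constants. -/
theorem exists_strip_layer {d : ℕ} {f g : ℂ[X]} (hf : f.natDegree ≤ d + 1)
    (hg : g.natDegree ≤ d + 1)
    (h : ∀ z : ℂ, ‖z‖ = 1 → ‖f.eval z‖ ^ 2 + ‖g.eval z‖ ^ 2 = 1) :
    ∃ (a b : ℂ) (f' g' : ℂ[X]), a * conj a + b * conj b = 1 ∧ f'.natDegree ≤ d ∧ g'.natDegree ≤ d ∧
      (∀ z : ℂ, ‖z‖ = 1 → ‖f'.eval z‖ ^ 2 + ‖g'.eval z‖ ^ 2 = 1) ∧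
      f = C a * f' - C (conj b) * (X * g') ∧ g = C b * f' + C (conj a) * (X * g') := by
  -- The relation |f|² + |g|² = 1 becomes a polynomial identity. As d + 1 > 0, its constant
  -- coefficient says that the vector of constant coefficients of (f, g) is orthogonal to the vector
  -- of top coefficients.
  have hid : f * circRev (d + 1) f + g * circRev (d + 1) g = X ^ (d + 1) := by
    refine eq_of_eval_eq_on_circle fun z hz => ?_
    rw [eval_add, eval_mul_circRev hf hz, eval_mul_circRev hg hz, ← mul_add, ← Complex.ofReal_add,
      h z hz]
    simp
  have horth : f.coeff 0 * conj (f.coeff (d + 1)) + g.coeff 0 * conj (g.coeff (d + 1)) = 0 := by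
    have := congrArg (fun p => coeff p 0) hid
    simpa [mul_coeff_zero, coeff_circRev_of_le, coeff_X_pow] using this
  obtain ⟨a, b, hab, h1, h2⟩ := exists_unit_vector_of_orthogonal horth
  have hC : C a * C (conj a) + C b * C (conj b) = (1 : ℂ[X]) := by
    rw [← C_mul, ← C_mul, ← C_add, hab, C_1]
  -- Undoing the rotation with columns (a, b) and (-conj b, conj a) gives a first component without
  -- top coefficient and a second component, `G`, without constant term; the latter is divided by X.
  set G : ℂ[X] := C a * g - C b * f with hG
  have hGX : X * G.divX = G := by
    have e := divX_mul_X_add G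
    have : G.coeff 0 = 0 := by simp [hG, mul_coeff_zero]; linear_combination -h1
    rw [this, C_0, add_zero, mul_comm] at e
    exact e
  refine ⟨a, b, C (conj a) * f + C (conj b) * g, G.divX, hab, ?_, ?_, ?_, ?_, ?_⟩
  · have hle : (C (conj a) * f + C (conj b) * g).natDegree ≤ d + 1 :=
      (natDegree_add_le _ _).trans (max_le ((natDegree_C_mul_le _ _).trans hf)
        ((natDegree_C_mul_le _ _).trans hg))
    have := natDegree_le_pred hle (by simpa using h2)
    simpa using this
  · rw [natDegree_divX_eq_natDegree_tsub_one]
    have : G.natDegree ≤ d + 1 := (natDegree_sub_le _ _).trans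
      (max_le ((natDegree_C_mul_le _ _).trans hg) ((natDegree_C_mul_le _ _).trans hf))
    omega
  · intro z hz
    have e1 : ‖G.divX.eval z‖ ^ 2 = ‖G.eval z‖ ^ 2 := by
      conv_rhs => rw [← hGX]
      rw [eval_mul, eval_X, norm_mul, hz, one_mul]
    rw [e1, ← h z hz]
    apply Complex.ofReal_injective
    simp only [Complex.ofReal_add, ← Complex.normSq_eq_norm_sq, ← Complex.mul_conj, hG, eval_add,
      eval_sub, eval_mul, eval_C, map_add, map_sub, map_mul, Complex.conj_conj]
    linear_combination (f.eval z * conj (f.eval z) + g.eval z * conj (g.eval z)) * hab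
  · rw [hGX, hG]
    linear_combination -f * hC
  · rw [hGX, hG]
    linear_combination -g * hC

/-- The polynomial `z ^ K * F(z)` with `F(e^{2iθ}) = e^{iθ} P(cos θ)`, where `P = x * G(x²)`. -/
noncomputable def liftOdd (K : ℕ) (G : ℝ[X]) : ℂ[X] :=
  C (1 / 2) * (1 + X) * ∑ j ∈ Finset.range (K + 1),
    C (G.coeff j : ℂ) * ((C (1 / 4) * (1 + X) ^ 2) ^ j * X ^ (K - j))

theorem natDegree_liftOdd_le (K : ℕ) (G : ℝ[X]) : (liftOdd K G).natDegree ≤ 2 * K + 1 := by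
  have h1 : (C (1 / 2 : ℂ) * (1 + X) : ℂ[X]).natDegree ≤ 1 := by compute_degree
  have h2 : (C (1 / 4 : ℂ) * (1 + X) ^ 2 : ℂ[X]).natDegree ≤ 2 := by compute_degree
  refine natDegree_mul_le.trans ?_
  have : (∑ j ∈ Finset.range (K + 1),
    C (G.coeff j : ℂ) * ((C (1 / 4) * (1 + X) ^ 2) ^ j * X ^ (K - j)) : ℂ[X]).natDegree ≤ 2 * K := by
    refine natDegree_sum_le_of_forall_le _ _ fun j hj => ?_
    have hj' := Finset.mem_range.mp hj
    refine (natDegree_C_mul_le _ _).trans (natDegree_mul_le.trans ?_)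
    rw [natDegree_X_pow]
    have : ((C (1 / 4 : ℂ) * (1 + X) ^ 2) ^ j : ℂ[X]).natDegree ≤ j * 2 :=
      natDegree_pow_le.trans (by gcongr)
    omega
  omega

/-- Write z = w² with |w| = 1. Then 1 + w² = 2w Re w, so the value is a unit complex number times
the odd polynomial at Re w. -/
theorem norm_eval_liftOdd_lt_one {K : ℕ} {G : ℝ[X]} (hK : G.natDegree ≤ K)
    (hG : ∀ x : ℝ, |x| ≤ 1 → |x * G.eval (x ^ 2)| < 1) {z : ℂ} (hz : ‖z‖ = 1) :
    ‖(liftOdd K G).eval z‖ < 1 := by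
  obtain ⟨w, rfl⟩ := IsAlgClosed.exists_pow_nat_eq z two_pos
  have hw : ‖w‖ = 1 := by
    rw [norm_pow] at hz
    exact (pow_eq_one_iff_of_nonneg (norm_nonneg w) two_ne_zero).mp hz
  have hx : w * conj w = 1 := mul_conj_eq_one_of_norm_eq_one hw
  have hre : (w.re : ℂ) = (w + conj w) / 2 := by rw [Complex.add_conj]; push_cast; ring
  have e1 : (1 + w ^ 2 : ℂ) = 2 * (w * w.re) := by rw [hre]; linear_combination -hx
  have e2 : (liftOdd K G).eval (w ^ 2)
      = w * (w ^ 2) ^ K * ((w.re * G.eval (w.re ^ 2) : ℝ) : ℂ) := by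
    have : ∀ j ∈ Finset.range (K + 1), (G.coeff j : ℂ) * ((1 / 4 * (1 + w ^ 2) ^ 2) ^ j
        * (w ^ 2) ^ (K - j)) = (w ^ 2) ^ K * ((G.coeff j * (w.re ^ 2) ^ j : ℝ) : ℂ) := by
      intro j hj
      have hj' := Finset.mem_range.mp hj
      have hjK : (w ^ 2) ^ K = (w ^ 2) ^ j * (w ^ 2) ^ (K - j) := by
        rw [← pow_add]; congr 1; omega
      have : (1 / 4 * (2 * (w * w.re)) ^ 2 : ℂ) = w ^ 2 * w.re ^ 2 := by ring
      rw [e1, this, hjK]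
      push_cast
      rw [mul_pow]
      ring
    simp only [liftOdd, eval_mul, eval_C, eval_add, eval_one, eval_X, eval_finsetSum, eval_pow]
    rw [Finset.sum_congr rfl this, ← Finset.mul_sum, ← Complex.ofReal_sum,
      ← eval_eq_sum_range' (Nat.lt_succ_of_le hK), e1]
    push_cast
    ring
  rw [e2, norm_mul, norm_mul, norm_pow, norm_pow, hw, Complex.norm_real]
  simpa using hG w.re ((Complex.abs_re_le_norm w).trans hw.le)

end FejerRiesz

/-! ### Operators placed on a subset of the wires -/

section PlaceOp

variable {V W : Type}

open Classical in
theorem placeOp_apply (e : V ↪ W) (U : QOp V) (x y : W → Fin 2) :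
    placeOp e U x y
      = if ∀ w, w ∉ Set.range e → x w = y w then U (x ∘ e) (y ∘ e) else 0 := rfl

theorem extend_comp_embedding (e : V ↪ W) (t : V → Fin 2) (x : W → Fin 2) :
    Function.extend e t x ∘ e = t :=
  funext fun v => e.injective.extend_apply t x v

theorem extend_apply_of_notMem_range (e : V ↪ W) (t : V → Fin 2) (x : W → Fin 2) {w : W}
    (hw : w ∉ Set.range e) : Function.extend e t x w = x w :=
  Function.extend_apply' t x w fun ⟨v, hv⟩ => hw ⟨v, hv⟩

theorem eq_of_agree_of_comp_eq {e : V ↪ W} {x y : W → Fin 2}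
    (h : ∀ w, w ∉ Set.range e → x w = y w) (h' : x ∘ e = y ∘ e) : x = y := by
  funext w
  by_cases hw : w ∈ Set.range e
  · obtain ⟨v, rfl⟩ := hw
    exact congrFun h' v
  · exact h w hw

variable [Fintype V] [Fintype W]

theorem sum_ite_agree_off_range [DecidableEq V] [DecidableEq W] (e : V ↪ W) (x : W → Fin 2)
    [∀ y : W → Fin 2, Decidable (∀ w, w ∉ Set.range e → x w = y w)] (f : (W → Fin 2) → ℂ) :
    ∑ y, (if ∀ w, w ∉ Set.range e → x w = y w then f y else 0)
      = ∑ t : V → Fin 2, f (Function.extend e t x) := by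
  symm
  refine Fintype.sum_of_injective (fun t => Function.extend e t x) ?_
    (fun t => f (Function.extend e t x))
    (fun y => if ∀ w, w ∉ Set.range e → x w = y w then f y else 0) ?_ ?_
  · intro t t' h
    have := congrArg (fun z => z ∘ e) h
    simpa [extend_comp_embedding] using this
  · intro y hy
    rw [if_neg]
    intro h
    refine hy ⟨y ∘ e, eq_of_agree_of_comp_eq (e := e) (fun w hw => ?_) (extend_comp_embedding _ _ _)⟩
    exact (extend_apply_of_notMem_range e _ _ hw).trans (h w hw)
  · intro t
    rw [if_pos fun w hw => (extend_apply_of_notMem_range e _ _ hw).symm]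

theorem placeOp_mul [DecidableEq V] [DecidableEq W] (e : V ↪ W) (A B : QOp V) :
    placeOp e (A * B) = placeOp e A * placeOp e B := by
  classical
  ext x y
  simp only [Matrix.mul_apply, placeOp_apply e (A * B), placeOp_apply e A, ite_mul, zero_mul]
  rw [sum_ite_agree_off_range e x (fun z => A (x ∘ e) (z ∘ e) * placeOp e B z y)]
  simp only [placeOp_apply]
  by_cases h : ∀ w, w ∉ Set.range e → x w = y w
  · rw [if_pos h]
    refine Finset.sum_congr rfl fun t _ => ?_
    rw [extend_comp_embedding, if_pos]
    intro w hw
    rw [extend_apply_of_notMem_range e _ _ hw, h w hw]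
  · rw [if_neg h]
    symm
    refine Finset.sum_eq_zero fun t _ => ?_
    rw [if_neg, mul_zero]
    intro h'
    refine h fun w hw => ?_
    rw [← h' w hw, extend_apply_of_notMem_range e _ _ hw]

theorem placeOp_one [DecidableEq W] (e : V ↪ W) : placeOp e (1 : QOp V) = 1 := by
  ext x y
  rw [placeOp_apply, Matrix.one_apply, Matrix.one_apply]
  by_cases h : x = y
  · subst h; simp
  · rw [if_neg h]
    split_ifs with h1 h2
    · exact absurd (eq_of_agree_of_comp_eq h1 h2) h
    · rfl
    · rfl

end PlaceOp

/-! ### Controlled single-wire operators and permutations of basis states -/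

section Mux

variable {V W : Type}

theorem placeOp_conjTranspose (e : V ↪ W) (A : QOp V) : placeOp e Aᴴ = (placeOp e A)ᴴ := by
  ext x y
  rw [Matrix.conjTranspose_apply, placeOp_apply, placeOp_apply, Matrix.conjTranspose_apply]
  by_cases h : ∀ w, w ∉ Set.range e → x w = y w
  · rw [if_pos h, if_pos fun w hw => (h w hw).symm]
  · rw [if_neg h, if_neg fun h' => h fun w hw => (h' w hw).symm, star_zero]

theorem placeOp_mem_unitaryGroup [Fintype V] [DecidableEq V] [Fintype W] [DecidableEq W]
    (e : V ↪ W) {A : QOp V} (hA : A ∈ Matrix.unitaryGroup (V → Fin 2) ℂ) :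
    placeOp e A ∈ Matrix.unitaryGroup (W → Fin 2) ℂ := by
  rw [Matrix.mem_unitaryGroup_iff, Matrix.star_eq_conjTranspose] at hA ⊢
  rw [← placeOp_conjTranspose, ← placeOp_mul, hA, placeOp_one]

/-- The value of `g` does not depend on the wire `t`. -/
def IndepOf [DecidableEq W] {α : Type*} (t : W) (g : (W → Fin 2) → α) : Prop :=
  ∀ x b, g (Function.update x t b) = g x

/-- The single-wire operator `g x` acting on wire `t`, controlled by the other wires of `x`. -/
noncomputable def mux (t : W) (g : (W → Fin 2) → Matrix (Fin 2) (Fin 2) ℂ) : QOp W :=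
  open Classical in
  Matrix.of fun x y => if ∀ w, w ≠ t → x w = y w then g x (x t) (y t) else 0

open Classical in
theorem mux_apply (t : W) (g : (W → Fin 2) → Matrix (Fin 2) (Fin 2) ℂ) (x y : W → Fin 2) :
    mux t g x y = if ∀ w, w ≠ t → x w = y w then g x (x t) (y t) else 0 := rfl

theorem mux_add (t : W) (g₁ g₂ : (W → Fin 2) → Matrix (Fin 2) (Fin 2) ℂ) :
    mux t g₁ + mux t g₂ = mux t fun x => g₁ x + g₂ x := by
  ext x y
  simp only [Matrix.add_apply, mux_apply]
  split_ifs <;> simp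

theorem mux_smul (t : W) (c : ℂ) (g : (W → Fin 2) → Matrix (Fin 2) (Fin 2) ℂ) :
    c • mux t g = mux t fun x => c • g x := by
  ext x y
  simp only [Matrix.smul_apply, mux_apply]
  split_ifs <;> simp

theorem placeOp_mux (e : V ↪ W) (t : V) (g : (V → Fin 2) → Matrix (Fin 2) (Fin 2) ℂ) :
    placeOp e (mux t g) = mux (e t) fun x => g (x ∘ e) := by
  ext x y
  simp only [placeOp_apply, mux_apply, Function.comp_apply]
  by_cases h : ∀ w, w ≠ e t → x w = y w
  · rw [if_pos h, if_pos, if_pos]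
    · exact fun v hv => h _ (e.injective.ne hv)
    · exact fun w hw => h _ fun h' => hw ⟨t, h'.symm⟩
  · rw [if_neg h]
    split_ifs with h1 h2
    · refine absurd (fun w hw => ?_) h
      by_cases hwr : w ∈ Set.range e
      · obtain ⟨v, rfl⟩ := hwr
        exact h2 v fun h' => hw (h' ▸ rfl)
      · exact h1 w hwr
    · rfl
    · rfl

variable [DecidableEq W]

theorem IndepOf.eq_of_agree {α : Type*} {t : W} {g : (W → Fin 2) → α} (hg : IndepOf t g)
    {x y : W → Fin 2} (h : ∀ w, w ≠ t → x w = y w) : g x = g y := by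
  rw [← hg x (y t)]
  congr 1
  funext w
  by_cases hw : w = t
  · subst hw; simp
  · rw [Function.update_of_ne hw, h w hw]

theorem mux_conjTranspose {t : W} {g : (W → Fin 2) → Matrix (Fin 2) (Fin 2) ℂ} (hg : IndepOf t g) :
    (mux t g)ᴴ = mux t fun x => (g x)ᴴ := by
  ext x y
  rw [Matrix.conjTranspose_apply, mux_apply, mux_apply, Matrix.conjTranspose_apply]
  by_cases h : ∀ w, w ≠ t → x w = y w
  · rw [if_pos h, if_pos fun w hw => (h w hw).symm, hg.eq_of_agree h]
  · rw [if_neg h, if_neg fun h' => h fun w hw => (h' w hw).symm, star_zero]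

theorem indepOf_const {α : Type*} (t : W) (a : α) : IndepOf t (fun _ => a) := fun _ _ => rfl

variable [Fintype W]

open Classical in
theorem sum_ite_agree_off_wire (t : W) (x : W → Fin 2) (f : (W → Fin 2) → ℂ) :
    ∑ y, (if ∀ w, w ≠ t → x w = y w then f y else 0)
      = ∑ b : Fin 2, f (Function.update x t b) := by
  symm
  refine Fintype.sum_of_injective (fun b => Function.update x t b) (Function.update_injective x t)
    _ _ ?_ ?_
  · intro y hy
    rw [if_neg]
    intro h
    refine hy ⟨y t, ?_⟩
    funext w
    by_cases hw : w = t
    · subst hw; simp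
    · simp [Function.update_of_ne hw, h w hw]
  · intro b
    rw [if_pos]
    intro w hw
    simp [Function.update_of_ne hw]

theorem mux_mul_apply (t : W) (g : (W → Fin 2) → Matrix (Fin 2) (Fin 2) ℂ) (M : QOp W)
    (x y : W → Fin 2) :
    (mux t g * M) x y = ∑ b, g x (x t) b * M (Function.update x t b) y := by
  classical
  simp only [Matrix.mul_apply, mux_apply, ite_mul, zero_mul]
  rw [sum_ite_agree_off_wire t x (fun z => g x (x t) (z t) * M z y)]
  simp

theorem mux_mul (t : W) (g₁ : (W → Fin 2) → Matrix (Fin 2) (Fin 2) ℂ)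
    {g₂ : (W → Fin 2) → Matrix (Fin 2) (Fin 2) ℂ} (h₂ : IndepOf t g₂) :
    mux t g₁ * mux t g₂ = mux t fun x => g₁ x * g₂ x := by
  ext x y
  rw [mux_mul_apply]
  simp only [mux_apply, Matrix.mul_apply, h₂ x, Function.update_self]
  have : ∀ b, (∀ w, w ≠ t → Function.update x t b w = y w) ↔ ∀ w, w ≠ t → x w = y w :=
    fun b => forall₂_congr fun w hw => by rw [Function.update_of_ne hw]
  simp only [this]
  split_ifs <;> simp

theorem mux_one (t : W) : mux t (fun _ => 1) = (1 : QOp W) := by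
  ext x y
  rw [mux_apply, Matrix.one_apply, Matrix.one_apply]
  by_cases h : x = y
  · subst h; simp
  · rw [if_neg h]
    split_ifs with h1 h2
    · refine absurd (funext fun w => ?_) h
      by_cases hw : w = t
      · rw [hw, h2]
      · exact h1 w hw
    · rfl
    · rfl

theorem mux_mem_unitaryGroup {t : W} {g : (W → Fin 2) → Matrix (Fin 2) (Fin 2) ℂ}
    (hg : IndepOf t g) (hu : ∀ x, g x ∈ Matrix.unitaryGroup (Fin 2) ℂ) :
    mux t g ∈ Matrix.unitaryGroup (W → Fin 2) ℂ := by
  rw [Matrix.mem_unitaryGroup_iff, Matrix.star_eq_conjTranspose, mux_conjTranspose hg,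
    mux_mul _ _ (fun x b => by simp only [hg x b]), ← mux_one t]
  congr 1
  funext x
  exact Matrix.mem_unitaryGroup_iff.mp (hu x)

/-- The entries of the product are computed in one order only; the other order is the adjoint of a
product of the same kind. -/
theorem commute_mux_placeOp [Fintype V] [DecidableEq V] {e : V ↪ W} {t : W}
    (ht : t ∉ Set.range e) (g : Matrix (Fin 2) (Fin 2) ℂ) (U : QOp V) :
    Commute (mux t fun _ => g) (placeOp e U) := by
  classical
  have hc : ∀ (x : W → Fin 2) b, Function.update x t b ∘ e = x ∘ e := fun x b => funext fun v => by
    rw [Function.comp_apply, Function.update_of_ne (fun h => ht ⟨v, h⟩), Function.comp_apply]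
  have hcond : ∀ x y : W → Fin 2, ∀ b,
      (∀ w, w ∉ Set.range e → Function.update x t b w = y w) ↔
        b = y t ∧ ∀ w, w ∉ Set.range e → w ≠ t → x w = y w := by
    intro x y b
    constructor
    · intro h
      refine ⟨by simpa using h t ht, fun w hw hwt => ?_⟩
      simpa [Function.update_of_ne hwt] using h w hw
    · rintro ⟨rfl, h⟩ w hw
      by_cases hwt : w = t
      · subst hwt; simp
      · rw [Function.update_of_ne hwt]; exact h w hw hwt
  have key : ∀ (A : QOp V) (g : Matrix (Fin 2) (Fin 2) ℂ) (x y : W → Fin 2),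
      ((mux t fun _ => g) * placeOp e A) x y
        = if ∀ w, w ∉ Set.range e → w ≠ t → x w = y w then g (x t) (y t) * A (x ∘ e) (y ∘ e)
          else 0 := by
    intro A g x y
    rw [mux_mul_apply]
    simp only [placeOp_apply, hc, hcond]
    by_cases h : ∀ w, w ∉ Set.range e → w ≠ t → x w = y w
    · simp only [and_iff_left h, if_pos h, mul_ite, mul_zero, Finset.sum_ite_eq', Finset.mem_univ,
        if_true]
    · simp only [h, and_false, if_false, mul_zero, Finset.sum_const_zero]
  have key2 : (placeOp e U * mux t fun _ => g)ᴴ = (mux t fun _ => gᴴ) * placeOp e Uᴴ := by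
    rw [Matrix.conjTranspose_mul, mux_conjTranspose (indepOf_const t g), placeOp_conjTranspose]
  have key3 : placeOp e U * (mux t fun _ => g) = ((mux t fun _ => gᴴ) * placeOp e Uᴴ)ᴴ := by
    rw [← key2, Matrix.conjTranspose_conjTranspose]
  rw [commute_iff_eq, key3]
  ext x y
  rw [Matrix.conjTranspose_apply, key, key]
  by_cases h : ∀ w, w ∉ Set.range e → w ≠ t → x w = y w
  · rw [if_pos h, if_pos fun w hw hwt => (h w hw hwt).symm]
    simp
  · rw [if_neg h, if_neg fun h' => h fun w hw hwt => (h' w hw hwt).symm, star_zero]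

/-- The operator which maps the basis state `y` to the basis state `σ y`. -/
noncomputable def permOp (σ : (W → Fin 2) → (W → Fin 2)) : QOp W :=
  Matrix.of fun x y => if x = σ y then 1 else 0

theorem mul_permOp_apply (M : QOp W) (σ : (W → Fin 2) → (W → Fin 2)) (x y : W → Fin 2) :
    (M * permOp σ) x y = M x (σ y) := by
  simp [Matrix.mul_apply, permOp]

theorem permOp_comp (σ τ : (W → Fin 2) → (W → Fin 2)) :
    permOp (σ ∘ τ) = permOp σ * permOp τ := by
  ext x y
  rw [mul_permOp_apply]
  rfl

theorem permOp_mul_apply {σ : (W → Fin 2) → (W → Fin 2)} (hσ : ∀ x, σ (σ x) = x) (M : QOp W)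
    (x y : W → Fin 2) : (permOp σ * M) x y = M (σ x) y := by
  have : ∀ z, x = σ z ↔ σ x = z := fun z =>
    ⟨fun h => by rw [h, hσ], fun h => by rw [← h, hσ]⟩
  simp [Matrix.mul_apply, permOp, this]

/-- Adds `f x` to wire `s`. -/
def toggle (s : W) (f : (W → Fin 2) → Fin 2) (x : W → Fin 2) : W → Fin 2 :=
  Function.update x s (x s + f x)

/-- `M` if `b = 1`, the identity if `b = 0`. -/
noncomputable def sel (M : Matrix (Fin 2) (Fin 2) ℂ) (b : Fin 2) : Matrix (Fin 2) (Fin 2) ℂ :=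
  if b = 1 then M else 1

def pauliX : Matrix (Fin 2) (Fin 2) ℂ := !![0, 1; 1, 0]

def pauliZ : Matrix (Fin 2) (Fin 2) ℂ := !![1, 0; 0, -1]

theorem sel_pauliX_apply (b i j : Fin 2) : sel pauliX b i j = if i = j + b then 1 else 0 := by
  fin_cases b <;> fin_cases i <;> fin_cases j <;> simp [sel, pauliX]

theorem mux_sel_pauliX {s : W} {f : (W → Fin 2) → Fin 2} (hf : IndepOf s f) :
    mux s (fun x => sel pauliX (f x)) = permOp (toggle s f) := by
  ext x y
  have key : x = toggle s f y ↔ (∀ w, w ≠ s → x w = y w) ∧ x s = y s + f y := by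
    constructor
    · rintro rfl
      exact ⟨fun w hw => by simp [toggle, Function.update_of_ne hw], by simp [toggle]⟩
    · rintro ⟨h, h'⟩
      funext w
      by_cases hw : w = s
      · subst hw; simpa [toggle] using h'
      · simpa [toggle, Function.update_of_ne hw] using h w hw
  simp only [mux_apply, sel_pauliX_apply]
  change _ = if x = toggle s f y then (1 : ℂ) else 0
  by_cases h : ∀ w, w ≠ s → x w = y w
  · rw [if_pos h, hf.eq_of_agree h]
    by_cases h' : x s = y s + f y
    · rw [if_pos h', if_pos (key.mpr ⟨h, h'⟩)]
    · rw [if_neg h', if_neg fun h'' => h' (key.mp h'').2]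
  · rw [if_neg h, if_neg fun h' => h (key.mp h').1]

omit [Fintype W] in
theorem toggle_toggle {s : W} {f : (W → Fin 2) → Fin 2} (hf : IndepOf s f) (x : W → Fin 2) :
    toggle s f (toggle s f x) = x := by
  have h2 : ∀ a b : Fin 2, a + b + b = a := by decide
  simp only [toggle, hf x, Function.update_self, Function.update_idem, h2, Function.update_eq_self]

/-- This is how a control condition gets computed: conjugation by the toggle of wire s substitutes
the toggled value of s into the control g. It requires that the toggle function depend neither on s
nor on the target t. -/
theorem permOp_toggle_conj_mux {s t : W} (hst : s ≠ t) {f : (W → Fin 2) → Fin 2}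
    (hfs : IndepOf s f) (hft : IndepOf t f) (g : (W → Fin 2) → Matrix (Fin 2) (Fin 2) ℂ) :
    permOp (toggle s f) * mux t g * permOp (toggle s f) = mux t fun x => g (toggle s f x) := by
  ext x y
  rw [mul_permOp_apply, permOp_mul_apply (toggle_toggle hfs), mux_apply, mux_apply]
  have ht : ∀ x, toggle s f x t = x t := fun x => Function.update_of_ne hst.symm _ _
  rw [ht, ht]
  suffices key : (∀ w, w ≠ t → toggle s f x w = toggle s f y w) ↔ ∀ w, w ≠ t → x w = y w by
    by_cases h : ∀ w, w ≠ t → x w = y w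
    · rw [if_pos h, if_pos (key.mpr h)]
    · rw [if_neg h, if_neg fun h' => h (key.mp h')]
  refine ⟨fun h => ?_, fun h => ?_⟩
  · have h' : ∀ w, w ≠ t → w ≠ s → x w = y w := by
      intro w hw hws
      simpa [toggle, Function.update_of_ne hws] using h w hw
    intro w hw
    by_cases hws : w = s
    · subst hws
      have e := h w hw
      simp only [toggle, Function.update_self] at e
      have hf : f x = f y := by
        rw [← hfs x (y w)]
        refine hft.eq_of_agree fun w' hw' => ?_
        by_cases hw2 : w' = w
        · subst hw2; simp
        · rw [Function.update_of_ne hw2]; exact h' w' hw' hw2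
      rw [hf] at e
      have : ∀ a b c : Fin 2, a + c = b + c → a = b := by decide
      exact this _ _ _ e
    · exact h' w hw hws
  · intro w hw
    have hf : f x = f y := hft.eq_of_agree h
    by_cases hws : w = s
    · subst hws; simp [toggle, hf, h w hw]
    · simp [toggle, Function.update_of_ne hws, h w hw]

end Mux

/-! ### Multiply controlled gates from two-qubit gates and borrowed wires -/

section ElementaryCircuits

variable {V₁ V₂ W : Type} [Fintype W] [DecidableEq W]

theorem OracleCircuit.toOp_append (A : QOp V₁) (B : QOp V₂) (c c' : OracleCircuit V₁ V₂ W) :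
    OracleCircuit.toOp A B (c ++ c') = OracleCircuit.toOp A B c' * OracleCircuit.toOp A B c := by
  induction c with
  | nil => simp [OracleCircuit.toOp]
  | cons g c ih => simp [OracleCircuit.toOp, ih, mul_assoc]

variable (V₁ V₂) in
/-- `M` is implemented by at most `N` elementary gates. -/
def ElemImpl (N : ℕ) (M : QOp W) : Prop :=
  ∃ c : OracleCircuit V₁ V₂ W, (∀ g ∈ c, g.isElementary = true) ∧ c.length ≤ N ∧
    ∀ A B, OracleCircuit.toOp A B c = M

theorem ElemImpl.mul {N N' : ℕ} {M M' : QOp W} (h : ElemImpl V₁ V₂ N M)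
    (h' : ElemImpl V₁ V₂ N' M') : ElemImpl V₁ V₂ (N + N') (M * M') := by
  obtain ⟨c, h1, h2, h3⟩ := h
  obtain ⟨c', h1', h2', h3'⟩ := h'
  refine ⟨c' ++ c, ?_, ?_, fun A B => ?_⟩
  · intro g hg
    rcases List.mem_append.mp hg with hg | hg
    exacts [h1' g hg, h1 g hg]
  · rw [List.length_append]; omega
  · rw [OracleCircuit.toOp_append, h3, h3']

theorem ElemImpl.mono {N N' : ℕ} {M : QOp W} (h : ElemImpl V₁ V₂ N M) (hN : N ≤ N') :
    ElemImpl V₁ V₂ N' M := by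
  obtain ⟨c, h1, h2, h3⟩ := h
  exact ⟨c, h1, h2.trans hN, h3⟩

theorem ElemImpl.placeOp {k : ℕ} (hk : k ≤ 2) (e : Fin k ↪ W) {u : QOp (Fin k)}
    (hu : u ∈ Matrix.unitaryGroup (Fin k → Fin 2) ℂ) : ElemImpl V₁ V₂ 1 (placeOp e u) :=
  ⟨[OracleGate.elementary k hk e ⟨u, hu⟩], by simp [OracleGate.isElementary], by simp,
    fun A B => by simp [OracleCircuit.toOp, OracleGate.toOp]⟩

theorem ElemImpl.mux_const (t : W) {g : Matrix (Fin 2) (Fin 2) ℂ}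
    (hg : g ∈ Matrix.unitaryGroup (Fin 2) ℂ) : ElemImpl V₁ V₂ 1 (mux t fun _ => g) := by
  have h := ElemImpl.placeOp (V₁ := V₁) (V₂ := V₂) one_le_two
    (⟨fun _ => t, fun _ _ _ => Subsingleton.elim _ _⟩ : Fin 1 ↪ W)
    (mux_mem_unitaryGroup (indepOf_const (0 : Fin 1) g) fun _ => hg)
  rw [placeOp_mux] at h
  exact h

theorem ElemImpl.mux_wire {s t : W} (hst : s ≠ t) {g : Fin 2 → Matrix (Fin 2) (Fin 2) ℂ}
    (hg : ∀ b, g b ∈ Matrix.unitaryGroup (Fin 2) ℂ) :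
    ElemImpl V₁ V₂ 1 (mux t fun x => g (x s)) := by
  have hinj : Function.Injective ![s, t] := by
    intro i j h
    fin_cases i <;> fin_cases j <;> simp_all [hst.symm]
  have hind : IndepOf (1 : Fin 2) (fun x : Fin 2 → Fin 2 => g (x 0)) := fun x b => by
    simp only [Function.update_of_ne (zero_ne_one : (0 : Fin 2) ≠ 1)]
  have h := ElemImpl.placeOp (V₁ := V₁) (V₂ := V₂) le_rfl (⟨![s, t], hinj⟩ : Fin 2 ↪ W)
    (mux_mem_unitaryGroup hind fun x => hg (x 0))
  rw [placeOp_mux] at h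
  exact h

theorem sel_mem_unitaryGroup {M : Matrix (Fin 2) (Fin 2) ℂ}
    (hM : M ∈ Matrix.unitaryGroup (Fin 2) ℂ) (b : Fin 2) :
    sel M b ∈ Matrix.unitaryGroup (Fin 2) ℂ := by
  unfold sel
  split_ifs
  · exact hM
  · exact one_mem _

theorem pauliX_mem_unitaryGroup : pauliX ∈ Matrix.unitaryGroup (Fin 2) ℂ := by
  rw [Matrix.mem_unitaryGroup_iff, Matrix.star_eq_conjTranspose]
  ext i j
  fin_cases i <;> fin_cases j <;> simp [pauliX, Matrix.mul_apply]

theorem pauliZ_mem_unitaryGroup : pauliZ ∈ Matrix.unitaryGroup (Fin 2) ℂ := by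
  rw [Matrix.mem_unitaryGroup_iff, Matrix.star_eq_conjTranspose]
  ext i j
  fin_cases i <;> fin_cases j <;> simp [pauliZ, Matrix.mul_apply]

/-- A square root of `pauliX`. -/
noncomputable def sqrtX : Matrix (Fin 2) (Fin 2) ℂ :=
  !![(1 + Complex.I) / 2, (1 - Complex.I) / 2; (1 - Complex.I) / 2, (1 + Complex.I) / 2]

theorem sqrtX_mul_conjTranspose : sqrtX * sqrtXᴴ = 1 := by
  have h2 : (starRingEnd ℂ) 2 = 2 := Complex.conj_ofReal 2
  ext i j
  fin_cases i <;> fin_cases j <;> simp [sqrtX, Matrix.mul_apply, h2] <;> ring_nf <;> simp <;>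
    norm_num

theorem sqrtX_mem_unitaryGroup : sqrtX ∈ Matrix.unitaryGroup (Fin 2) ℂ :=
  Matrix.mem_unitaryGroup_iff.mpr sqrtX_mul_conjTranspose

theorem sqrtX_mul_self : sqrtX * sqrtX = pauliX := by
  ext i j
  fin_cases i <;> fin_cases j <;> simp [sqrtX, pauliX, Matrix.mul_apply] <;> ring_nf <;> simp <;>
    norm_num

/-- With S² = X, the exponents add up to u + v - (u xor v) = 2uv. -/
theorem sel_sqrtX_mul (u v : Fin 2) :
    sel sqrtX u * sel sqrtXᴴ (v + u) * sel sqrtX v = sel pauliX (u * v) := by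
  have h2 : sqrtXᴴ * sqrtX = 1 :=
    Matrix.mem_unitaryGroup_iff'.mp sqrtX_mem_unitaryGroup
  fin_cases u <;> fin_cases v <;>
    simp [sel, sqrtX_mul_conjTranspose, sqrtX_mul_self, h2]

/-- The Hadamard gate. -/
noncomputable def hadamard : Matrix (Fin 2) (Fin 2) ℂ :=
  (((Real.sqrt 2)⁻¹ : ℝ) : ℂ) • !![1, 1; 1, -1]

theorem inv_sqrt_two_mul_self : (((Real.sqrt 2)⁻¹ : ℝ) : ℂ) * (((Real.sqrt 2)⁻¹ : ℝ) : ℂ) = 1 / 2 := by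
  rw [← Complex.ofReal_mul, ← mul_inv, Real.mul_self_sqrt (by norm_num)]
  norm_num

theorem hadamard_mul_self : hadamard * hadamard = 1 := by
  rw [hadamard, smul_mul_smul_comm, inv_sqrt_two_mul_self]
  ext i j
  fin_cases i <;> fin_cases j <;> simp <;> norm_num

theorem hadamard_conjTranspose : hadamardᴴ = hadamard := by
  rw [hadamard, Matrix.conjTranspose_smul, Complex.star_def, Complex.conj_ofReal]
  congr 1
  ext i j
  fin_cases i <;> fin_cases j <;> simp

theorem hadamard_mem_unitaryGroup : hadamard ∈ Matrix.unitaryGroup (Fin 2) ℂ := by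
  rw [Matrix.mem_unitaryGroup_iff, Matrix.star_eq_conjTranspose, hadamard_conjTranspose,
    hadamard_mul_self]

theorem hadamard_mul_sel_pauliX_mul (b : Fin 2) :
    hadamard * sel pauliX b * hadamard = sel pauliZ b := by
  have h : hadamard * pauliX * hadamard = pauliZ := by
    rw [hadamard, smul_mul_assoc, smul_mul_smul_comm, inv_sqrt_two_mul_self]
    ext i j
    fin_cases i <;> fin_cases j <;> simp [pauliX, pauliZ] <;> norm_num
  unfold sel
  split_ifs
  · exact h
  · rw [mul_one, hadamard_mul_self]

/-- The Toffoli gate with controls `a` (negated if `p = 1`) and `b` and target `t`. -/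
theorem ElemImpl.toffoli {a b t : W} (hab : a ≠ b) (hat : a ≠ t) (hbt : b ≠ t) (p : Fin 2) :
    ElemImpl V₁ V₂ 5 (permOp (toggle t fun x => (x a + p) * x b)) := by
  have i1 : IndepOf t (fun x : W → Fin 2 => sel sqrtX (x b)) := fun x c => by
    simp only [Function.update_of_ne hbt]
  have i2 : IndepOf b (fun x : W → Fin 2 => x a + p) := fun x c => by
    simp only [Function.update_of_ne hab]
  have i2t : IndepOf t (fun x : W → Fin 2 => x a + p) := fun x c => by
    simp only [Function.update_of_ne hat]
  have i4 : IndepOf t (fun x : W → Fin 2 => (x a + p) * x b) := fun x c => by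
    simp only [Function.update_of_ne hbt, Function.update_of_ne hat]
  have i3 : IndepOf t (fun x : W → Fin 2 => sel sqrtXᴴ (x b + (x a + p))) := fun x c => by
    simp only [Function.update_of_ne hbt, Function.update_of_ne hat]
  have m1 : ElemImpl V₁ V₂ 1 (mux t fun x => sel sqrtX (x b)) :=
    ElemImpl.mux_wire hbt fun c => sel_mem_unitaryGroup sqrtX_mem_unitaryGroup c
  have m3 : ElemImpl V₁ V₂ 1 (mux t fun x => sel sqrtXᴴ (x b)) :=
    ElemImpl.mux_wire hbt fun c => sel_mem_unitaryGroup
      (Unitary.star_mem sqrtX_mem_unitaryGroup) c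
  have m5 : ElemImpl V₁ V₂ 1 (mux t fun x => sel sqrtX (x a + p)) :=
    ElemImpl.mux_wire (g := fun c => sel sqrtX (c + p)) hat
      fun c => sel_mem_unitaryGroup sqrtX_mem_unitaryGroup _
  have m2 : ElemImpl V₁ V₂ 1 (permOp (toggle b fun x => x a + p)) := by
    rw [← mux_sel_pauliX i2]
    exact ElemImpl.mux_wire (g := fun c => sel pauliX (c + p)) hab
      fun c => sel_mem_unitaryGroup pauliX_mem_unitaryGroup _
  -- The three middle gates write the xor into b, apply the controlled inverse root and restore b.
  have h := (m5.mul ((m2.mul m3).mul m2)).mul m1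
  rw [permOp_toggle_conj_mux hbt i2 i2t] at h
  have hb : ∀ x : W → Fin 2, toggle b (fun x => x a + p) x b = x b + (x a + p) := fun x => by
    simp [toggle]
  simp only [hb] at h
  rw [mux_mul _ _ i3, mux_mul _ _ i1] at h
  simp only [sel_sqrtX_mul] at h
  rwa [mux_sel_pauliX i4] at h

/-- The conjunction of the literals `x (c i) + p i` for `i ≤ k`. -/
def andLits (c : ℕ → W) (p : ℕ → Fin 2) : ℕ → (W → Fin 2) → Fin 2
  | 0, x => x (c 0) + p 0
  | k + 1, x => (x (c (k + 1)) + p (k + 1)) * andLits c p k x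

omit [Fintype W] [DecidableEq W] in
theorem andLits_congr {c : ℕ → W} {p : ℕ → Fin 2} {k : ℕ} {x y : W → Fin 2}
    (h : ∀ i ≤ k, x (c i) = y (c i)) : andLits c p k x = andLits c p k y := by
  induction k with
  | zero => simp [andLits, h 0 le_rfl]
  | succ k ih => rw [andLits, andLits, h _ le_rfl, ih fun i hi => h i (hi.trans (Nat.le_succ k))]

omit [Fintype W] [DecidableEq W] in
theorem andLits_eq_one_iff {c : ℕ → W} {p : ℕ → Fin 2} {k : ℕ} {x : W → Fin 2} :
    andLits c p k x = 1 ↔ ∀ i ≤ k, x (c i) + p i = 1 := by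
  have hm : ∀ a b : Fin 2, a * b = 1 ↔ a = 1 ∧ b = 1 := by decide
  induction k with
  | zero => simp [andLits]
  | succ k ih =>
    refine (hm _ _).trans ((and_congr Iff.rfl ih).trans ?_)
    constructor
    · rintro ⟨h1, h2⟩ i hi
      rcases Nat.le_succ_iff.mp hi with h | rfl
      exacts [h2 i h, h1]
    · exact fun h => ⟨h _ le_rfl, fun i hi => h i (hi.trans (Nat.le_succ k))⟩

/-- A ladder of Toffoli gates which adds the conjunction of the first `i + 1` literals to each wire
`d i`, whatever the values of these wires. -/
theorem ElemImpl.ladder {c d : ℕ → W} (p : ℕ → Fin 2) (k : ℕ)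
    (hd : ∀ i ≤ k, ∀ j ≤ k, d i = d j → i = j) (hcd : ∀ i ≤ k, ∀ j ≤ k, c i ≠ d j) :
    ∃ σ : (W → Fin 2) → (W → Fin 2), ElemImpl V₁ V₂ (10 * k + 1) (permOp σ) ∧
      (∀ x, ∀ i ≤ k, σ x (d i) = x (d i) + andLits c p i x) ∧
      ∀ x w, (∀ i ≤ k, w ≠ d i) → σ x w = x w := by
  induction k with
  | zero =>
    have hne := hcd 0 le_rfl 0 le_rfl
    have i2 : IndepOf (d 0) (fun x : W → Fin 2 => x (c 0) + p 0) := fun x b => by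
      simp only [Function.update_of_ne hne]
    refine ⟨toggle (d 0) fun x => x (c 0) + p 0, ?_, ?_, ?_⟩
    · rw [← mux_sel_pauliX i2]
      exact ElemImpl.mux_wire (g := fun b => sel pauliX (b + p 0)) hne
        fun b => sel_mem_unitaryGroup pauliX_mem_unitaryGroup _
    · intro x i hi
      obtain rfl := Nat.le_zero.mp hi
      simp [toggle, andLits]
    · intro x w hw
      simp [toggle, Function.update_of_ne (hw 0 le_rfl)]
  | succ k ih =>
    obtain ⟨σ, hσ, h1, h2⟩ := ih (fun i hi j hj => hd i (by omega) j (by omega))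
      (fun i hi j hj => hcd i (by omega) j (by omega))
    set T : (W → Fin 2) → (W → Fin 2) :=
      toggle (d (k + 1)) fun x => (x (c (k + 1)) + p (k + 1)) * x (d k) with hT
    have hdk : d k ≠ d (k + 1) := fun h => by
      have := hd k (by omega) (k + 1) le_rfl h
      omega
    have hTi : ElemImpl V₁ V₂ 5 (permOp T) :=
      ElemImpl.toffoli (hcd _ le_rfl _ (by omega)) (hcd _ le_rfl _ le_rfl) hdk _
    have hTself : ∀ x, T x (d (k + 1)) = x (d (k + 1)) + (x (c (k + 1)) + p (k + 1)) * x (d k) :=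
      fun x => by simp [hT, toggle]
    have hTne : ∀ x w, w ≠ d (k + 1) → T x w = x w := fun x w hw => by
      simp [hT, toggle, Function.update_of_ne hw]
    have hcne : ∀ i ≤ k + 1, ∀ x, T x (c i) = x (c i) := fun i hi x => hTne x _ (hcd i hi _ le_rfl)
    have hσc : ∀ i ≤ k + 1, ∀ x, σ x (c i) = x (c i) := fun i hi x =>
      h2 x _ fun j hj => hcd i hi j (by omega)
    have hσd : ∀ x, σ x (d (k + 1)) = x (d (k + 1)) := fun x => h2 x _ fun j hj h => by
      have := hd (k + 1) le_rfl j (by omega) h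
      omega
    have hand : ∀ i ≤ k, ∀ x, andLits c p i (T x) = andLits c p i x := fun i hi x =>
      andLits_congr fun j hj => hcne j (by omega) x
    -- Wire d (k+1) receives the literal times d k twice, before and after the inner ladder has
    -- added the shorter conjunction to d k. The unknown initial value of d k cancels modulo 2.
    refine ⟨T ∘ σ ∘ T, ?_, ?_, ?_⟩
    · rw [permOp_comp, permOp_comp]
      exact (hTi.mul (hσ.mul hTi)).mono (by omega)
    · intro x i hi
      simp only [Function.comp_apply]
      rcases Nat.le_succ_iff.mp hi with h | rfl
      · have hdi : d i ≠ d (k + 1) := fun h' => by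
          have := hd i hi (k + 1) le_rfl h'
          omega
        rw [hTne _ _ hdi, h1 _ i h, hTne _ _ hdi, hand i h]
      · rw [hTself, hσd, hTself, hσc _ le_rfl, hcne _ le_rfl, h1 _ k le_rfl, hTne _ _ hdk,
          hand k le_rfl, andLits]
        have : ∀ a b c d : Fin 2, a + b * c + b * (c + d) = a + b * d := by decide
        exact this _ _ _ _
    · intro x w hw
      simp only [Function.comp_apply]
      rw [hTne _ _ (hw _ le_rfl), h2 _ _ fun i hi => hw i (by omega), hTne _ _ (hw _ le_rfl)]

/-- The multiply controlled `X` gate with borrowed wires `d i`, `i < k`. -/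
theorem ElemImpl.multiControlledX {c d : ℕ → W} (p : ℕ → Fin 2) (k : ℕ)
    (hd : ∀ i ≤ k, ∀ j ≤ k, d i = d j → i = j) (hcd : ∀ i ≤ k, ∀ j ≤ k, c i ≠ d j) :
    ElemImpl V₁ V₂ (20 * k + 2) (permOp (toggle (d k) (andLits c p k))) := by
  obtain ⟨σ, hσ, h1, h2⟩ := ElemImpl.ladder (V₁ := V₁) (V₂ := V₂) p k hd hcd
  cases k with
  | zero =>
    have : toggle (d 0) (andLits c p 0) = σ := by
      funext x w
      by_cases hw : w = d 0
      · subst hw; rw [h1 x 0 le_rfl]; simp [toggle]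
      · rw [h2 x w fun i hi => by rwa [Nat.le_zero.mp hi]]; simp [toggle, Function.update_of_ne hw]
    rw [this]
    exact hσ.mono (by omega)
  | succ k =>
    -- The full ladder alters every d i. A second ladder, one rung shorter, restores all of them but
    -- the target.
    obtain ⟨τ, hτ, h1', h2'⟩ := ElemImpl.ladder (V₁ := V₁) (V₂ := V₂) p k
      (fun i hi j hj => hd i (by omega) j (by omega))
      (fun i hi j hj => hcd i (by omega) j (by omega))
    have : toggle (d (k + 1)) (andLits c p (k + 1)) = τ ∘ σ := by
      funext x w
      rw [Function.comp_apply]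
      by_cases hw : w = d (k + 1)
      · subst hw
        rw [h2' _ _ fun i hi h => by have := hd _ le_rfl i (by omega) h; omega, h1 x _ le_rfl]
        simp [toggle]
      rw [toggle, Function.update_of_ne hw]
      by_cases hw' : ∃ i ≤ k, w = d i
      · obtain ⟨i, hi, rfl⟩ := hw'
        have : andLits c p i (σ x) = andLits c p i x := andLits_congr fun j hj =>
          h2 x _ fun l hl => hcd j (by omega) l hl
        rw [h1' _ i hi, h1 _ i (by omega), this]
        have : ∀ a b : Fin 2, a = a + b + b := by decide
        exact this _ _
      · push Not at hw'
        rw [h2' _ _ hw', h2]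
        intro i hi
        rcases Nat.le_succ_iff.mp hi with h | rfl
        exacts [hw' i h, hw]
    rw [this, permOp_comp]
    exact (hτ.mul hσ).mono (by omega)

/-- The reflection about the zero state of the wires `a i`, controlled by `q`, with one borrowed
wire `s`. -/
theorem ElemImpl.controlledReflection {m : ℕ} (a : Fin m ↪ W) {q s : W}
    (hq : q ∉ Set.range a) (hs : s ∉ Set.range a) (hsq : s ≠ q) :
    ElemImpl V₁ V₂ (40 * m + 10)
      (mux q fun x => open Classical in if ∀ i, x (a i) = 0 then pauliZ else 1) := by
  classical
  rcases Nat.eq_zero_or_pos m with rfl | hm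
  · have h := ElemImpl.mux_const (V₁ := V₁) (V₂ := V₂) q pauliZ_mem_unitaryGroup
    simp only [IsEmpty.forall_iff, if_true]
    exact h.mono (by omega)
  obtain ⟨w, hw⟩ : ∃ w : ℕ → W, ∀ i (h : i < m), w i = a ⟨i, h⟩ :=
    ⟨fun i => if h : i < m then a ⟨i, h⟩ else q, fun i h => dif_pos h⟩
  have winj : ∀ i < m, ∀ j < m, w i = w j → i = j := fun i hi j hj h => by
    rw [hw i hi, hw j hj] at h
    simpa using a.injective h
  have wq : ∀ i < m, w i ≠ q := fun i hi h => hq ⟨⟨i, hi⟩, (hw i hi).symm.trans h⟩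
  have ws : ∀ i < m, w i ≠ s := fun i hi h => hs ⟨⟨i, hi⟩, (hw i hi).symm.trans h⟩
  have hzero : ∀ x : W → Fin 2, (∀ i, x (a i) = 0) ↔ ∀ i < m, x (w i) = 0 := fun x =>
    ⟨fun h i hi => by rw [hw i hi]; exact h _, fun h i => by rw [← hw i i.2]; exact h i i.2⟩
  -- The zero tests are split into a block of k₁ + 1 wires, whose conjunction is toggled into s, and
  -- a block of k₂ wires, tested jointly with s. As k₁ ≤ k₂ ≤ k₁ + 1, each block provides the
  -- borrowed wires for the other. The literal offset is 1 for a zero test and 0 for the test s = 1.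
  obtain ⟨k₂, hk₂⟩ : ∃ k, k = m / 2 := ⟨_, rfl⟩
  obtain ⟨k₁, hk₁⟩ : ∃ k, k + 1 + k₂ = m := ⟨m - k₂ - 1, by omega⟩
  set d₁ : ℕ → W := fun i => if i < k₁ then w (k₁ + 1 + i) else s with hd₁
  set c₂ : ℕ → W := fun i => if i = 0 then s else w (k₁ + i) with hc₂
  set p₂ : ℕ → Fin 2 := fun i => if i = 0 then 0 else 1 with hp₂
  set d₂ : ℕ → W := fun i => if i < k₂ then w i else q with hd₂
  have t₁ : ElemImpl V₁ V₂ (20 * k₁ + 2) (permOp (toggle s (andLits w (fun _ => 1) k₁))) := by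
    have := ElemImpl.multiControlledX (V₁ := V₁) (V₂ := V₂) (c := w) (d := d₁) (fun _ => 1) k₁ ?_ ?_
    · simpa [hd₁] using this
    · intro i hi j hj h
      simp only [hd₁] at h
      split_ifs at h with h1 h2 h2
      · have := winj _ (by omega) _ (by omega) h; omega
      · exact absurd h (ws _ (by omega))
      · exact absurd h.symm (ws _ (by omega))
      · omega
    · intro i hi j hj h
      simp only [hd₁] at h
      split_ifs at h with h1
      · have := winj _ (by omega) _ (by omega) h; omega
      · exact absurd h (ws _ (by omega))
  have t₂ : ElemImpl V₁ V₂ (20 * k₂ + 2) (permOp (toggle q (andLits c₂ p₂ k₂))) := by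
    have := ElemImpl.multiControlledX (V₁ := V₁) (V₂ := V₂) (c := c₂) (d := d₂) p₂ k₂ ?_ ?_
    · simpa [hd₂] using this
    · intro i hi j hj h
      simp only [hd₂] at h
      split_ifs at h with h1 h2 h2
      · exact winj _ (by omega) _ (by omega) h
      · exact absurd h (wq _ (by omega))
      · exact absurd h.symm (wq _ (by omega))
      · omega
    · intro i hi j hj h
      simp only [hd₂, hc₂] at h
      split_ifs at h with h1 h2 h2
      · exact absurd h.symm (ws _ (by omega))
      · exact hsq h
      · have := winj _ (by omega) _ (by omega) h; omega
      · exact absurd h (wq _ (by omega))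
  have i₁s : IndepOf s (andLits w (fun _ => 1) k₁) := fun x b => andLits_congr fun i hi =>
    Function.update_of_ne (ws i (by omega)) _ _
  have i₁q : IndepOf q (andLits w (fun _ => 1) k₁) := fun x b => andLits_congr fun i hi =>
    Function.update_of_ne (wq i (by omega)) _ _
  have c₂q : ∀ i ≤ k₂, c₂ i ≠ q := fun i hi => by
    simp only [hc₂]
    split_ifs
    exacts [hsq, wq _ (by omega)]
  have i₂q : IndepOf q (andLits c₂ p₂ k₂) := fun x b => andLits_congr fun i hi =>
    Function.update_of_ne (c₂q i hi) _ _
  have i₂q' : IndepOf q (fun x => sel pauliZ (andLits c₂ p₂ k₂ x)) := fun x b => by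
    simp only [i₂q x b]
  have D : ElemImpl V₁ V₂ (20 * k₂ + 4) (mux q fun x => sel pauliZ (andLits c₂ p₂ k₂ x)) := by
    have hH := ElemImpl.mux_const (V₁ := V₁) (V₂ := V₂) q hadamard_mem_unitaryGroup
    have h := (hH.mul t₂).mul hH
    rw [← mux_sel_pauliX i₂q, mux_mul _ _ (fun x b => by simp only [i₂q x b]),
      mux_mul _ _ (indepOf_const q _)] at h
    simp only [hadamard_mul_sel_pauliX_mul] at h
    exact h.mono (by omega)
  -- If g and A denote the two block conjunctions, the two copies of `D` contribute Z^{(s+g)A} and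
  -- Z^{sA}, whose product is Z^{gA} whatever the value of the borrowed wire s.
  have h := ((t₁.mul D).mul t₁).mul D
  rw [permOp_toggle_conj_mux hsq i₁s i₁q, mux_mul _ _ i₂q'] at h
  have hZ : pauliZ * pauliZ = 1 := by
    ext i j
    fin_cases i <;> fin_cases j <;> simp [pauliZ, Matrix.mul_apply]
  have e : ∀ x : W → Fin 2,
      sel pauliZ (andLits c₂ p₂ k₂ (toggle s (andLits w (fun _ => 1) k₁) x)) *
        sel pauliZ (andLits c₂ p₂ k₂ x) = if ∀ i, x (a i) = 0 then pauliZ else 1 := by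
    intro x
    set g := andLits w (fun _ => 1) k₁ x with hg
    have g1 : g = 1 ↔ ∀ i ≤ k₁, x (w i) = 0 := by
      rw [hg, andLits_eq_one_iff]
      have : ∀ b : Fin 2, b + 1 = 1 ↔ b = 0 := by decide
      simp only [this]
    have a2 : ∀ y : W → Fin 2, andLits c₂ p₂ k₂ y = 1 ↔
        y s = 1 ∧ ∀ i < k₂, y (w (k₁ + 1 + i)) = 0 := by
      intro y
      rw [andLits_eq_one_iff]
      have h1 : ∀ b : Fin 2, b + 1 = 1 ↔ b = 0 := by decide
      have h0 : ∀ b : Fin 2, b + 0 = 1 ↔ b = 1 := by decide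
      constructor
      · intro h
        refine ⟨by simpa [hc₂, hp₂] using h 0 (Nat.zero_le _), fun i hi => ?_⟩
        have := h (i + 1) (by omega)
        simp only [hc₂, hp₂, Nat.succ_ne_zero, if_false, h1] at this
        rwa [show k₁ + 1 + i = k₁ + (i + 1) by omega]
      · rintro ⟨h, h'⟩ i hi
        rcases Nat.eq_zero_or_pos i with rfl | hi0
        · simpa [hc₂, hp₂] using h
        · simp only [hc₂, hp₂, hi0.ne', if_false, h1]
          have := h' (i - 1) (by omega)
          rwa [show k₁ + 1 + (i - 1) = k₁ + i by omega] at this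
    have hall : (∀ i, x (a i) = 0) ↔ g = 1 ∧ ∀ i < k₂, x (w (k₁ + 1 + i)) = 0 := by
      rw [hzero, g1]
      constructor
      · exact fun h => ⟨fun i hi => h i (by omega), fun i hi => h _ (by omega)⟩
      · rintro ⟨h, h'⟩ i hi
        rcases Nat.lt_or_ge k₁ i with h3 | h3
        · have := h' (i - k₁ - 1) (by omega)
          rwa [show k₁ + 1 + (i - k₁ - 1) = i by omega] at this
        · exact h i h3
    have ts : toggle s (andLits w (fun _ => 1) k₁) x s = x s + g := by simp [toggle, hg]
    have tn : ∀ i < m, toggle s (andLits w (fun _ => 1) k₁) x (w i) = x (w i) := fun i hi =>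
      Function.update_of_ne (ws i hi) _ _
    have a2' : andLits c₂ p₂ k₂ (toggle s (andLits w (fun _ => 1) k₁) x) = 1 ↔
        x s + g = 1 ∧ ∀ i < k₂, x (w (k₁ + 1 + i)) = 0 := by
      rw [a2, ts]
      exact and_congr_right fun _ => forall₂_congr fun i hi => by rw [tn _ (by omega)]
    simp only [sel, a2', a2 x, hall]
    have b01 : ∀ b : Fin 2, b = 0 ∨ b = 1 := by decide
    by_cases hA : ∀ i < k₂, x (w (k₁ + 1 + i)) = 0
    · have hA' : (∀ i < k₂, x (w (k₁ + 1 + i)) = 0) = True := eq_true hA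
      simp only [hA', and_true]
      rcases b01 g with h0 | h0 <;> rcases b01 (x s) with h3 | h3 <;> simp [h0, h3, hZ]
    · simp [hA]
  simp only [e] at h
  exact h.mono (by omega)

end ElementaryCircuits

/-! ### Zero blocks as compressions by ⟨0| and matrix units on a wire -/

section BlockEncodingAlgebra

variable {M n : ℕ}

/-- `⟨0^M| ⊗ I_n`. -/
def bra (M n : ℕ) : Matrix (Fin n → Fin 2) (Fin M ⊕ Fin n → Fin 2) ℂ :=
  Matrix.of fun x y => if Sum.elim (fun _ => 0) x = y then 1 else 0

theorem bra_apply (x : Fin n → Fin 2) (y : Fin M ⊕ Fin n → Fin 2) :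
    bra M n x y = if Sum.elim (fun _ => 0) x = y then 1 else 0 := rfl

theorem bra_mul_apply {κ : Type*} (A : Matrix (Fin M ⊕ Fin n → Fin 2) κ ℂ) (x : Fin n → Fin 2)
    (y : κ) : (bra M n * A) x y = A (Sum.elim (fun _ => 0) x) y := by
  simp [Matrix.mul_apply, bra_apply]

theorem mul_bra_conjTranspose_apply {κ : Type*} (A : Matrix κ (Fin M ⊕ Fin n → Fin 2) ℂ) (x : κ)
    (y : Fin n → Fin 2) : (A * (bra M n)ᴴ) x y = A x (Sum.elim (fun _ => 0) y) := by
  simp [Matrix.mul_apply, bra_apply, apply_ite (starRingEnd ℂ)]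

theorem zeroBlock_eq (U : QOp (Fin M ⊕ Fin n)) : zeroBlock U = bra M n * U * (bra M n)ᴴ := by
  ext x y
  rw [mul_bra_conjTranspose_apply, bra_mul_apply]
  rfl

theorem zeroBlock_conjTranspose (U : QOp (Fin M ⊕ Fin n)) : zeroBlock Uᴴ = (zeroBlock U)ᴴ := rfl

/-- The embedding of qubits which acts as `a` on ancillas and trivially on system qubits. -/
def ancillaEmb {m : ℕ} (a : Fin m ↪ Fin M) (n : ℕ) : Fin m ⊕ Fin n ↪ Fin M ⊕ Fin n :=
  a.sumMap (Function.Embedding.refl _)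

theorem elim_comp_ancillaEmb {m : ℕ} (a : Fin m ↪ Fin M) (x : Fin n → Fin 2) :
    (Sum.elim (fun _ => 0) x : Fin M ⊕ Fin n → Fin 2) ∘ ancillaEmb a n
      = Sum.elim (fun _ => 0) x := by
  funext w
  rcases w with w | w <;> rfl

theorem inl_notMem_range_ancillaEmb {m : ℕ} (a : Fin m ↪ Fin M) {l : Fin M}
    (hl : l ∉ Set.range a) : (Sum.inl l : Fin M ⊕ Fin n) ∉ Set.range (ancillaEmb a n) := by
  rintro ⟨w | w, hw⟩
  · exact hl ⟨w, Sum.inl_injective hw⟩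
  · simp [ancillaEmb] at hw

theorem inr_mem_range_ancillaEmb {m : ℕ} (a : Fin m ↪ Fin M) (l : Fin n) :
    (Sum.inr l : Fin M ⊕ Fin n) ∈ Set.range (ancillaEmb a n) :=
  ⟨Sum.inr l, rfl⟩

theorem bra_mul_placeOp_mul_conjTranspose {m : ℕ} (a : Fin m ↪ Fin M) (A : QOp (Fin m ⊕ Fin n)) :
    bra M n * placeOp (ancillaEmb a n) A * (bra M n)ᴴ = zeroBlock A := by
  ext x y
  rw [mul_bra_conjTranspose_apply, bra_mul_apply, placeOp_apply, elim_comp_ancillaEmb,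
    elim_comp_ancillaEmb, if_pos]
  · rfl
  · rintro (w | w) hw
    · rfl
    · exact absurd (inr_mem_range_ancillaEmb a w) hw

open Classical in
/-- The projector onto the zero state of the ancillas `a i`. -/
noncomputable def zeroProj {m : ℕ} (a : Fin m ↪ Fin M) (n : ℕ) : QOp (Fin M ⊕ Fin n) :=
  Matrix.diagonal fun x => if ∀ i, x (Sum.inl (a i)) = 0 then 1 else 0

theorem bra_mul_zeroProj {m : ℕ} (a : Fin m ↪ Fin M) : bra M n * zeroProj a n = bra M n := by
  ext x y
  rw [zeroProj, Matrix.mul_diagonal, bra_apply]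
  split_ifs with h1 h2 h2
  · simp
  · subst h1; simp at h2
  · simp
  · simp

/-- The ancillas outside `a` are untouched, so ⟨0| on the left already forces them to be 0 on the
right. This row identity holds on every input state, including those left by the query to the other
black box. -/
theorem bra_mul_placeOp_mul_zeroProj {m : ℕ} (a : Fin m ↪ Fin M) (A : QOp (Fin m ⊕ Fin n)) :
    bra M n * placeOp (ancillaEmb a n) A * zeroProj a n = zeroBlock A * bra M n := by
  ext x y
  rw [zeroProj, Matrix.mul_diagonal, bra_mul_apply, placeOp_apply, elim_comp_ancillaEmb]
  have hr : (zeroBlock A * bra M n) x y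
      = if ∀ l, y (Sum.inl l) = 0 then zeroBlock A x (y ∘ Sum.inr) else 0 := by
    rw [Matrix.mul_apply]
    have : ∀ z : Fin n → Fin 2, bra M n z y
        = if z = y ∘ Sum.inr then (if ∀ l, y (Sum.inl l) = 0 then 1 else 0) else 0 := by
      intro z
      rw [bra_apply, ← ite_and]
      refine if_congr ⟨?_, ?_⟩ rfl rfl
      · rintro rfl
        exact ⟨rfl, fun _ => rfl⟩
      · rintro ⟨rfl, h⟩
        funext w
        rcases w with w | w
        · exact (h w).symm
        · rfl
    simp only [this, mul_ite, mul_one, mul_zero, Finset.sum_ite_eq', Finset.mem_univ, if_true]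
  rw [hr]
  by_cases h : ∀ l, y (Sum.inl l) = 0
  · rw [if_pos h, if_pos fun i => h _, if_pos, mul_one]
    · have : y ∘ ancillaEmb a n = Sum.elim (fun _ => 0) (y ∘ Sum.inr) := by
        funext w
        rcases w with w | w
        · exact h _
        · rfl
      rw [this]
      rfl
    · rintro (w | w) hw
      · exact (h w).symm
      · exact absurd (inr_mem_range_ancillaEmb a w) hw
  · rw [if_neg h]
    split_ifs with h1 h2
    · refine absurd (fun l => ?_) h
      by_cases hl : l ∈ Set.range a
      · obtain ⟨i, rfl⟩ := hl
        exact h2 i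
      · exact (h1 _ (inl_notMem_range_ancillaEmb a hl)).symm
    · simp
    · simp
    · simp

/-- A diagonal operator may be viewed as acting on any chosen wire, which brings the reflections
under the `mux` calculus. -/
theorem mux_scalar {W : Type} [Fintype W] [DecidableEq W] (t : W) (c : (W → Fin 2) → ℂ) :
    mux t (fun x => c x • 1) = Matrix.diagonal c := by
  ext x y
  rw [mux_apply, Matrix.diagonal_apply, Matrix.smul_apply, Matrix.one_apply]
  by_cases h : x = y
  · subst h; simp
  · rw [if_neg h]
    split_ifs with h1 h2
    · refine absurd (funext fun w => ?_) h
      by_cases hw : w = t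
      · rw [hw, h2]
      · exact h1 w hw
    · simp
    · rfl

/-- The matrix unit `|i⟩⟨j|` on the wire `q`. -/
noncomputable def unitOp {W : Type} (q : W) (i j : Fin 2) : QOp W :=
  mux q fun _ => Matrix.single i j 1

section
variable {W : Type} [Fintype W] [DecidableEq W] (q : W)

theorem mux_const_mul (g g' : Matrix (Fin 2) (Fin 2) ℂ) :
    (mux q fun _ => g) * (mux q fun _ => g') = mux q fun _ => g * g' :=
  mux_mul q _ (indepOf_const q g')

omit [Fintype W] [DecidableEq W] in
theorem mux_const_eq (g : Matrix (Fin 2) (Fin 2) ℂ) :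
    (mux q fun _ => g) = g 0 0 • unitOp q 0 0 + g 0 1 • unitOp q 0 1 + g 1 0 • unitOp q 1 0
      + g 1 1 • unitOp q 1 1 := by
  simp only [unitOp, mux_smul, mux_add]
  congr 1
  funext _
  ext i j
  fin_cases i <;> fin_cases j <;> simp [Matrix.single]

theorem unitOp_mul_same (i j k : Fin 2) : unitOp q i j * unitOp q j k = unitOp q i k := by
  rw [unitOp, unitOp, mux_const_mul, Matrix.single_mul_single_same, one_mul, unitOp]

theorem unitOp_mul_of_ne (i : Fin 2) {j j' : Fin 2} (k : Fin 2) (h : j ≠ j') :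
    unitOp q i j * unitOp q j' k = 0 := by
  rw [unitOp, unitOp, mux_const_mul, Matrix.single_mul_single_of_ne _ _ _ _ h]
  ext x y
  rw [mux_apply]
  simp

theorem mux_const_mul_unitOp (g : Matrix (Fin 2) (Fin 2) ℂ) (j k : Fin 2) :
    (mux q fun _ => g) * unitOp q j k = g 0 j • unitOp q 0 k + g 1 j • unitOp q 1 k := by
  rw [mux_const_eq]
  have h01 : (0 : Fin 2) ≠ 1 := by decide
  fin_cases j <;> simp [add_mul, unitOp_mul_same, unitOp_mul_of_ne, h01]

theorem unitOp_add : unitOp q 0 0 + unitOp q 1 1 = 1 := by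
  have h := mux_const_eq q 1
  rw [mux_one] at h
  simpa using h.symm

end

theorem bra_mul_unitOp (l : Fin M) (i j : Fin 2) (hij : i = 0 → j = 0) :
    bra M n * unitOp (W := Fin M ⊕ Fin n) (Sum.inl l) i j = if i = 0 then bra M n else 0 := by
  ext x y
  rw [bra_mul_apply, unitOp, mux_apply]
  rcases (by decide : ∀ i : Fin 2, i = 0 ∨ i = 1) i with rfl | rfl
  · obtain rfl := hij rfl
    rw [if_pos rfl, bra_apply]
    by_cases h : (Sum.elim (fun _ => 0) x : Fin M ⊕ Fin n → Fin 2) = y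
    · subst h; simp
    · rw [if_neg h]
      split_ifs with h1
      · by_cases h2 : y (Sum.inl l) = 0
        · refine absurd (funext fun w => ?_) h
          by_cases hw : w = Sum.inl l
          · subst hw; exact h2.symm
          · exact h1 w hw
        · simp [Matrix.single, Ne.symm h2]
      · rfl
  · simp [Matrix.single]

theorem unitOp_conjTranspose {W : Type} [DecidableEq W] (q : W) (i j : Fin 2) :
    (unitOp q i j)ᴴ = unitOp q j i := by
  rw [unitOp, mux_conjTranspose (indepOf_const q _), unitOp]
  simp

end BlockEncodingAlgebra

/-! ### Row identities for the qubitized walk -/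

section QubitizedWalk

open Polynomial

variable {ι κ : Type*} [Fintype ι] [DecidableEq ι] [Fintype κ] [DecidableEq κ]

/-- The walk operator `U† R U R`. -/
def walkOp (U R : Matrix ι ι ℂ) : Matrix ι ι ℂ := Uᴴ * R * U * R

theorem walkOp_mem_unitaryGroup {U R : Matrix ι ι ℂ} (hU : U ∈ Matrix.unitaryGroup ι ℂ)
    (hR : R ∈ Matrix.unitaryGroup ι ℂ) : walkOp U R ∈ Matrix.unitaryGroup ι ℂ :=
  mul_mem (mul_mem (mul_mem (Unitary.star_mem hU) hR) hU) hR

variable {U P : Matrix ι ι ℂ} {B : Matrix κ ι ℂ} {h : Matrix κ κ ℂ}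

/-- The reflection `1 - 2 P`. -/
def reflOp (P : Matrix ι ι ℂ) : Matrix ι ι ℂ := 1 - (2 : ℂ) • P

omit [Fintype ι] in
theorem reflOp_conjTranspose (hP : Pᴴ = P) : (reflOp P)ᴴ = reflOp P := by
  rw [reflOp, Matrix.conjTranspose_sub, Matrix.conjTranspose_one, Matrix.conjTranspose_smul, hP,
    star_ofNat]

theorem reflOp_mem_unitaryGroup (hP : Pᴴ = P) (hPP : P * P = P) :
    reflOp P ∈ Matrix.unitaryGroup ι ℂ := by
  rw [Matrix.mem_unitaryGroup_iff, Matrix.star_eq_conjTranspose, reflOp_conjTranspose hP, reflOp,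
    two_smul]
  calc (1 - (P + P)) * (1 - (P + P)) = 1 - 4 • P + 4 • (P * P) := by noncomm_ring
    _ = 1 := by rw [hPP]; abel

omit [Fintype κ] [DecidableEq κ] in
theorem mul_reflOp (hB : B * P = B) : B * reflOp P = -B := by
  rw [reflOp, Matrix.mul_sub, Matrix.mul_smul, hB, Matrix.mul_one, two_smul]
  abel

omit [DecidableEq κ] in
-- Since U W = R U R and B R = -B, one gets B U W = -B U R = -B U + 2 B U P.
theorem row_mul_one_add_walkOp (hB : B * P = B) (hUP : B * U * P = h * B)
    (hU : U * Uᴴ = 1) : B * U * (1 + walkOp U (reflOp P)) = (2 : ℂ) • (h * B) := by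
  have e : U * walkOp U (reflOp P) = reflOp P * U * reflOp P := by
    simp only [walkOp, ← mul_assoc, hU, one_mul]
  rw [Matrix.mul_add, Matrix.mul_one, Matrix.mul_assoc B U (walkOp _ _), e, ← Matrix.mul_assoc,
    ← Matrix.mul_assoc, mul_reflOp hB, reflOp, Matrix.mul_sub, Matrix.mul_one, Matrix.mul_smul,
    Matrix.neg_mul, Matrix.neg_mul, hUP, smul_neg, two_smul]
  abel

omit [DecidableEq κ] in
-- Here W† = R U† R U, so B W† = -B U† R U = -B + 2 B U† P U. Together with the previous identity, B
-- (1 + W†)(1 + W) = 4h² B.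
theorem row_mul_one_add_walkOp_conjTranspose (hP : Pᴴ = P) (hB : B * P = B)
    (hUP : B * Uᴴ * P = h * B) (hU : Uᴴ * U = 1) :
    B * (1 + (walkOp U (reflOp P))ᴴ) = (2 : ℂ) • (h * (B * U)) := by
  have e : (walkOp U (reflOp P))ᴴ = (reflOp P) * (Uᴴ * ((reflOp P) * U)) := by
    simp only [walkOp, Matrix.conjTranspose_mul, reflOp_conjTranspose hP, Matrix.conjTranspose_conjTranspose, mul_assoc]
  rw [e, Matrix.mul_add, Matrix.mul_one, ← Matrix.mul_assoc, ← Matrix.mul_assoc, ← Matrix.mul_assoc,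
    mul_reflOp hB, reflOp, Matrix.mul_sub, Matrix.mul_one, Matrix.mul_smul, Matrix.neg_mul,
    Matrix.neg_mul, hUP, Matrix.sub_mul, Matrix.neg_mul, Matrix.mul_assoc B Uᴴ U, hU, Matrix.mul_one,
    Matrix.smul_mul, Matrix.neg_mul, smul_neg, two_smul, two_smul, Matrix.mul_assoc]
  abel

/-- In the j-th term Y^K cancels X^(K-j) and leaves Y^j, which turns each (1 + X)² into (1 + Y)(1 +
X). This is the form to which the row identities apply. -/
theorem pow_mul_aeval_liftOdd {X Y : Matrix ι ι ℂ} (hXY : X * Y = 1) (hYX : Y * X = 1) (K : ℕ)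
    (G : ℝ[X]) : Y ^ K * aeval X (liftOdd K G)
      = ((1 / 2 : ℂ) • (1 + X)) * ∑ j ∈ Finset.range (K + 1),
          (G.coeff j : ℂ) • ((1 / 4 : ℂ) • ((1 + Y) * (1 + X))) ^ j := by
  have hc : Commute Y X := hYX.trans hXY.symm
  have hc1 : Commute Y (1 + X) := (Commute.one_right Y).add_right hc
  have e1 : (1 + Y) * (1 + X) = Y * (1 + X) ^ 2 := by
    rw [sq, ← mul_assoc, mul_add Y, mul_one, hYX, add_comm Y]
  have e2 : ∀ j ≤ K, Y ^ K * (((1 / 4 : ℂ) • (1 + X) ^ 2) ^ j * X ^ (K - j))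
      = ((1 / 4 : ℂ) • ((1 + Y) * (1 + X))) ^ j := by
    intro j hj
    have hcq : Commute Y ((1 / 4 : ℂ) • (1 + X) ^ 2) := (hc1.pow_right 2).smul_right _
    have hcX : Commute ((1 / 4 : ℂ) • (1 + X) ^ 2) X :=
      ((((Commute.one_left X).add_left (Commute.refl X)).pow_left 2).smul_left _)
    rw [e1, ← mul_smul_comm, hcq.mul_pow, (hcX.pow_pow j (K - j)).eq, ← mul_assoc,
      show Y ^ K = Y ^ j * Y ^ (K - j) by rw [← pow_add]; congr 1; omega, mul_assoc (Y ^ j),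
      ← hc.mul_pow, hYX, one_pow, mul_one]
  have hcs : Commute (Y ^ K) ((1 / 2 : ℂ) • (1 + X)) := (hc1.pow_left K).smul_right _
  simp only [liftOdd, map_mul, map_add, map_sum, map_pow, aeval_C, aeval_X, map_one,
    ← Algebra.smul_def]
  rw [← mul_assoc, hcs.eq, mul_assoc, Finset.mul_sum]
  congr 1
  refine Finset.sum_congr rfl fun j hj => ?_
  rw [mul_smul_comm, e2 j (Nat.lt_succ_iff.mp (Finset.mem_range.mp hj))]

/-- The quantum signal processing identity for the odd polynomial `x * G(x²)`. -/
theorem row_mul_aeval_liftOdd (hP : Pᴴ = P) (hPP : P * P = P) (hB : B * P = B)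
    (hUP : B * U * P = h * B) (hUP' : B * Uᴴ * P = h * B) (hU : U * Uᴴ = 1) {K : ℕ} {G : ℝ[X]}
    (hK : G.natDegree ≤ K) :
    B * U * ((walkOp U (reflOp P))ᴴ ^ K * aeval (walkOp U (reflOp P)) (liftOdd K G))
      = h * aeval (h ^ 2) (G.map (algebraMap ℝ ℂ)) * B := by
  have hU' : Uᴴ * U = 1 := mul_eq_one_comm.mp hU
  have hW := walkOp_mem_unitaryGroup (Matrix.mem_unitaryGroup_iff.mpr hU)
    (reflOp_mem_unitaryGroup hP hPP)
  have hW1 := Matrix.mem_unitaryGroup_iff.mp hW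
  have hW2 := Matrix.mem_unitaryGroup_iff'.mp hW
  rw [Matrix.star_eq_conjTranspose] at hW1 hW2
  rw [pow_mul_aeval_liftOdd hW1 hW2]
  set W := walkOp U (reflOp P) with hWdef
  have s1 : B * U * ((1 / 2 : ℂ) • (1 + W)) = h * B := by
    rw [Matrix.mul_smul, row_mul_one_add_walkOp hB hUP hU, smul_smul]
    norm_num
  have s2 : B * ((1 / 4 : ℂ) • ((1 + Wᴴ) * (1 + W))) = h ^ 2 * B := by
    rw [Matrix.mul_smul, ← Matrix.mul_assoc, row_mul_one_add_walkOp_conjTranspose hP hB hUP' hU',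
      Matrix.smul_mul, Matrix.mul_assoc h, row_mul_one_add_walkOp hB hUP hU, Matrix.mul_smul,
      smul_smul, smul_smul, sq, Matrix.mul_assoc]
    norm_num
  have s3 : ∀ j, B * ((1 / 4 : ℂ) • ((1 + Wᴴ) * (1 + W))) ^ j = (h ^ 2) ^ j * B := by
    intro j
    induction j with
    | zero => simp
    | succ j ih => rw [pow_succ, ← Matrix.mul_assoc, ih, Matrix.mul_assoc, s2, ← Matrix.mul_assoc,
        ← pow_succ]
  rw [← Matrix.mul_assoc, s1, Matrix.mul_assoc, Matrix.mul_sum,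
    aeval_eq_sum_range' (n := K + 1) (natDegree_map_le.trans_lt (Nat.lt_succ_of_le hK)),
    Matrix.mul_assoc, Matrix.sum_mul]
  congr 1
  refine Finset.sum_congr rfl fun j _ => ?_
  rw [Matrix.mul_smul, s3, Matrix.smul_mul, coeff_map]
  rfl

end QubitizedWalk

/-! ### Generalized quantum signal processing -/

section SignalProcessingCircuits

open Polynomial ComplexConjugate

variable {V₁ V₂ W : Type} [Fintype W] [DecidableEq W]

variable (V₂) in
/-- `M A` is implemented, uniformly in the black boxes, by a circuit without queries to `B` which
makes at most `a` queries to `A` and has at most `e` elementary gates. -/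
def QueryImpl (a e : ℕ) (M : QOp V₁ → QOp W) : Prop :=
  ∃ c : OracleCircuit V₁ V₂ W, c.queryACount ≤ a ∧ c.queryBCount = 0 ∧ c.queryBInvCount = 0 ∧
    c.elementaryCount ≤ e ∧ ∀ A B, OracleCircuit.toOp A B c = M A

theorem QueryImpl.mul {a e a' e' : ℕ} {M M' : QOp V₁ → QOp W} (h : QueryImpl V₂ a e M)
    (h' : QueryImpl V₂ a' e' M') : QueryImpl V₂ (a + a') (e + e') fun A => M A * M' A := by
  obtain ⟨c, h1, h2, h3, h4, h5⟩ := h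
  obtain ⟨c', h1', h2', h3', h4', h5'⟩ := h'
  refine ⟨c' ++ c, ?_, ?_, ?_, ?_, fun A B => by rw [OracleCircuit.toOp_append, h5, h5']⟩
  all_goals
    simp only [OracleCircuit.queryACount, OracleCircuit.queryBCount, OracleCircuit.queryBInvCount,
      OracleCircuit.elementaryCount, List.countP_append] at *
    omega

theorem QueryImpl.mono {a e a' e' : ℕ} {M : QOp V₁ → QOp W} (h : QueryImpl V₂ a e M)
    (ha : a ≤ a') (he : e ≤ e') : QueryImpl V₂ a' e' M := by
  obtain ⟨c, h1, h2, h3, h4, h5⟩ := h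
  exact ⟨c, h1.trans ha, h2, h3, h4.trans he, h5⟩

theorem QueryImpl.pow {a e : ℕ} {M : QOp V₁ → QOp W} (h : QueryImpl V₂ a e M) (k : ℕ) :
    QueryImpl V₂ (k * a) (k * e) fun A => M A ^ k := by
  induction k with
  | zero => exact ⟨[], by simp [OracleCircuit.queryACount, OracleCircuit.queryBCount,
      OracleCircuit.queryBInvCount, OracleCircuit.elementaryCount, OracleCircuit.toOp]⟩
  | succ k ih =>
    simp only [pow_succ]
    exact (ih.mul h).mono (by rw [add_mul, one_mul]) (by rw [add_mul, one_mul])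

theorem ElemImpl.queryImpl {e : ℕ} {M : QOp W} (h : ElemImpl V₁ V₂ e M) :
    QueryImpl V₂ 0 e fun _ : QOp V₁ => M := by
  obtain ⟨c, h1, h2, h3⟩ := h
  have hz : ∀ p : OracleGate V₁ V₂ W → Bool, (∀ g, g.isElementary = true → p g = false) →
      c.countP p = 0 := fun p hp => List.countP_eq_zero.mpr fun g hg => by simp [hp g (h1 g hg)]
  refine ⟨c, (hz _ ?_).le, hz _ ?_, hz _ ?_, List.countP_le_length.trans h2, h3⟩
  all_goals
    intro g hg
    cases g with
    | elementary => rfl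
    | _ => exact absurd hg Bool.false_ne_true

theorem QueryImpl.query (e : V₁ ↪ W) : QueryImpl V₂ 1 0 fun A : QOp V₁ => placeOp e A :=
  ⟨[OracleGate.queryA e], le_of_eq rfl, rfl, rfl, le_of_eq rfl, fun A B => by
    simp [OracleCircuit.toOp, OracleGate.toOp]⟩

theorem QueryImpl.queryInv (e : V₁ ↪ W) : QueryImpl V₂ 1 0 fun A : QOp V₁ => placeOp e Aᴴ :=
  ⟨[OracleGate.queryAInv e], le_of_eq rfl, rfl, rfl, le_of_eq rfl, fun A B => by
    simp [OracleCircuit.toOp, OracleGate.toOp]⟩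

theorem OracleGate.toOp_mem_unitaryGroup [Fintype V₁] [DecidableEq V₁] [Fintype V₂] [DecidableEq V₂]
    {A : QOp V₁} {B : QOp V₂} (hA : A ∈ Matrix.unitaryGroup (V₁ → Fin 2) ℂ)
    (hB : B ∈ Matrix.unitaryGroup (V₂ → Fin 2) ℂ) (g : OracleGate V₁ V₂ W) :
    g.toOp A B ∈ Matrix.unitaryGroup (W → Fin 2) ℂ := by
  cases g with
  | elementary k hk e u => exact placeOp_mem_unitaryGroup e u.2
  | queryA e => exact placeOp_mem_unitaryGroup e hA
  | queryAInv e => exact placeOp_mem_unitaryGroup e (Unitary.star_mem hA)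
  | queryB e => exact placeOp_mem_unitaryGroup e hB
  | queryBInv e => exact placeOp_mem_unitaryGroup e (Unitary.star_mem hB)

theorem OracleCircuit.toOp_mem_unitaryGroup [Fintype V₁] [DecidableEq V₁] [Fintype V₂]
    [DecidableEq V₂] {A : QOp V₁} {B : QOp V₂} (hA : A ∈ Matrix.unitaryGroup (V₁ → Fin 2) ℂ)
    (hB : B ∈ Matrix.unitaryGroup (V₂ → Fin 2) ℂ) (c : OracleCircuit V₁ V₂ W) :
    OracleCircuit.toOp A B c ∈ Matrix.unitaryGroup (W → Fin 2) ℂ := by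
  induction c with
  | nil => exact one_mem _
  | cons g c ih => exact mul_mem ih (g.toOp_mem_unitaryGroup hA hB)

/-- Generalized quantum signal processing: any pair of complementary polynomials of the operator
`X A` is implemented by single-qubit rotations and controlled applications of `X A`. -/
theorem QueryImpl.signalProcessing {q : W} {Good : QOp V₁ → Prop} {X : QOp V₁ → QOp W}
    {cX : QOp V₁ → QOp W} {k : ℕ} (hcX : QueryImpl V₂ 2 k cX)
    (hX : ∀ A, Good A → cX A = unitOp q 0 0 + unitOp q 1 1 * X A)
    (hc : ∀ A, Good A → ∀ i j, Commute (unitOp q i j) (X A)) (d : ℕ) :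
    ∀ f g : ℂ[X], f.natDegree ≤ d → g.natDegree ≤ d →
      (∀ z : ℂ, ‖z‖ = 1 → ‖f.eval z‖ ^ 2 + ‖g.eval z‖ ^ 2 = 1) →
      ∃ O : QOp V₁ → QOp W, QueryImpl V₂ (2 * d) ((d + 1) * (k + 1)) O ∧
        ∀ A, Good A → O A * unitOp q 0 0
          = unitOp q 0 0 * aeval (X A) f + unitOp q 1 0 * aeval (X A) g := by
  have hrot : ∀ a b : ℂ, a * conj a + b * conj b = 1 →
      QueryImpl V₂ 0 1 fun _ : QOp V₁ => mux q fun _ => !![a, -conj b; b, conj a] := by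
    intro a b hab
    refine (ElemImpl.mux_const q ?_).queryImpl
    rw [Matrix.mem_unitaryGroup_iff, Matrix.star_eq_conjTranspose]
    ext i j
    fin_cases i <;> fin_cases j <;> simp [Matrix.mul_apply]
    · linear_combination hab
    · ring
    · ring
    · linear_combination hab
  induction d with
  | zero =>
    intro f g hf hg h
    obtain ⟨a, rfl⟩ := natDegree_eq_zero.mp (Nat.le_zero.mp hf)
    obtain ⟨b, rfl⟩ := natDegree_eq_zero.mp (Nat.le_zero.mp hg)
    have hab : a * conj a + b * conj b = 1 := by
      have := h 1 (by simp)
      simp only [eval_C] at this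
      rw [Complex.mul_conj, Complex.mul_conj, Complex.normSq_eq_norm_sq, Complex.normSq_eq_norm_sq,
        ← Complex.ofReal_add, this, Complex.ofReal_one]
    refine ⟨_, (hrot a b hab).mono (by omega) (by omega), fun A _ => ?_⟩
    rw [mux_const_mul_unitOp, aeval_C, aeval_C, Algebra.algebraMap_eq_smul_one,
      Algebra.algebraMap_eq_smul_one, mul_smul_comm, mul_smul_comm, mul_one, mul_one]
    simp
  | succ d ih =>
    intro f g hf hg h
    obtain ⟨a, b, f', g', hab, hf', hg', h', rfl, rfl⟩ := exists_strip_layer hf hg h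
    obtain ⟨O, hO, hOe⟩ := ih f' g' hf' hg' h'
    -- One layer consists of the circuit for the smaller pair, a controlled X A that multiplies the
    -- branch q = 1 by X A, and the rotation taken from `exists_strip_layer`.
    refine ⟨_, ((hrot a b hab).mul (hcX.mul hO)).mono (by omega) (by nlinarith), fun A hA => ?_⟩
    have h01 : (0 : Fin 2) ≠ 1 := by decide
    have step : cX A * (unitOp q 0 0 * aeval (X A) f' + unitOp q 1 0 * aeval (X A) g')
        = unitOp q 0 0 * aeval (X A) f' + unitOp q 1 0 * (X A * aeval (X A) g') := by
      rw [hX A hA, add_mul, mul_add, mul_add, ← mul_assoc, ← mul_assoc, unitOp_mul_same,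
        unitOp_mul_of_ne q 0 0 h01, zero_mul, add_zero, mul_assoc (unitOp q 1 1), ← mul_assoc (X A),
        ← (hc A hA 0 0).eq, mul_assoc (unitOp q 1 1), ← mul_assoc (X A), ← (hc A hA 1 0).eq,
        ← mul_assoc (unitOp q 1 1), ← mul_assoc (unitOp q 1 1), ← mul_assoc (unitOp q 1 1),
        ← mul_assoc (unitOp q 1 1), unitOp_mul_of_ne q 1 0 h01.symm, unitOp_mul_same]
      simp [mul_assoc]
    rw [mul_assoc, mul_assoc, hOe A hA, step, mul_add, ← mul_assoc, ← mul_assoc,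
      mux_const_mul_unitOp, mux_const_mul_unitOp]
    simp only [map_add, map_sub, map_mul, aeval_C, aeval_X, ← Algebra.smul_def, Matrix.of_apply,
      Matrix.cons_val_zero, Matrix.cons_val_one, Matrix.cons_val', Matrix.cons_val_fin_one]
    simp only [mul_add, mul_sub, add_mul, smul_mul_assoc, mul_smul_comm, neg_smul, neg_mul]
    abel

end SignalProcessingCircuits

/-! ### The controlled walk and the polynomial circuit -/

section ControlledWalk

variable {m M n : ℕ} {V₂ : Type}

theorem zeroProj_conjTranspose (a : Fin m ↪ Fin M) : (zeroProj a n)ᴴ = zeroProj a n := by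
  rw [zeroProj, Matrix.diagonal_conjTranspose]
  congr 1
  funext x
  simp [apply_ite (star : ℂ → ℂ)]

theorem zeroProj_mul_self (a : Fin m ↪ Fin M) : zeroProj a n * zeroProj a n = zeroProj a n := by
  rw [zeroProj, Matrix.diagonal_mul_diagonal]
  congr 1
  funext x
  split_ifs <;> simp

variable {a : Fin m ↪ Fin M} {l : Fin M}

open Classical in
theorem reflOp_zeroProj_eq_mux : reflOp (zeroProj a n) = mux (Sum.inl l)
    fun x => (if ∀ i, x (Sum.inl (a i)) = 0 then (-1 : ℂ) else 1) • 1 := by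
  rw [mux_scalar, reflOp, zeroProj, ← Matrix.diagonal_one, ← Matrix.diagonal_smul,
    Matrix.diagonal_sub]
  congr 1
  funext x
  simp only [Pi.smul_apply, smul_eq_mul]
  split_ifs <;> norm_num

theorem indepOf_of_notMem_range (hl : l ∉ Set.range a) {α : Type*} (p r : α) :
    IndepOf (Sum.inl l : Fin M ⊕ Fin n)
      (open Classical in fun x => if ∀ i, x (Sum.inl (a i)) = 0 then p else r) := by
  intro x b
  have : ∀ i, Function.update x (Sum.inl l) b (Sum.inl (a i)) = x (Sum.inl (a i)) := fun i =>
    Function.update_of_ne (fun h => hl ⟨i, Sum.inl_injective h⟩) _ _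
  simp only [this]

theorem commute_unitOp_reflOp (hl : l ∉ Set.range a) (i j : Fin 2) :
    Commute (unitOp (W := Fin M ⊕ Fin n) (Sum.inl l) i j) (reflOp (zeroProj a n)) := by
  rw [reflOp_zeroProj_eq_mux (l := l), unitOp, commute_iff_eq, mux_mul _ _ (indepOf_const _ _),
    mux_mul]
  · simp
  · intro x b
    exact congrArg (fun c : ℂ => c • (1 : Matrix (Fin 2) (Fin 2) ℂ))
      (indepOf_of_notMem_range hl (-1 : ℂ) 1 x b)

theorem QueryImpl.controlledReflection (hl : l ∉ Set.range a) (s : Fin n) :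
    QueryImpl V₂ 0 (40 * m + 10) fun _ : QOp (Fin m ⊕ Fin n) =>
      unitOp (W := Fin M ⊕ Fin n) (Sum.inl l) 0 0
        + unitOp (Sum.inl l) 1 1 * reflOp (zeroProj a n) := by
  have h := (ElemImpl.controlledReflection (V₁ := Fin m ⊕ Fin n) (V₂ := V₂)
    (a.trans ⟨Sum.inl, Sum.inl_injective⟩ : Fin m ↪ Fin M ⊕ Fin n)
    (q := Sum.inl l) (s := Sum.inr s) (fun ⟨i, hi⟩ => hl ⟨i, Sum.inl_injective hi⟩)
    (fun ⟨i, hi⟩ => by simp at hi) (by simp)).queryImpl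
  convert h using 2
  rw [reflOp_zeroProj_eq_mux (l := l), unitOp, unitOp, mux_mul, mux_add]
  · congr 1
    funext x
    simp only [Function.Embedding.trans_apply, Function.Embedding.coeFn_mk]
    split_ifs
    · ext i j
      fin_cases i <;> fin_cases j <;> simp [pauliZ, Matrix.single]
    · ext i j
      fin_cases i <;> fin_cases j <;> simp [Matrix.single]
  · intro x b
    exact congrArg (fun c : ℂ => c • (1 : Matrix (Fin 2) (Fin 2) ℂ))
      (indepOf_of_notMem_range hl (-1 : ℂ) 1 x b)

theorem commute_unitOp_placeOp (hl : l ∉ Set.range a) (i j : Fin 2) (A : QOp (Fin m ⊕ Fin n)) :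
    Commute (unitOp (W := Fin M ⊕ Fin n) (Sum.inl l) i j) (placeOp (ancillaEmb a n) A) :=
  commute_mux_placeOp (inl_notMem_range_ancillaEmb a hl) _ A

/-- The walk operator of the black box `A` on the ancillas `a` and the system qubits. -/
noncomputable def boxWalk (a : Fin m ↪ Fin M) (A : QOp (Fin m ⊕ Fin n)) : QOp (Fin M ⊕ Fin n) :=
  walkOp (placeOp (ancillaEmb a n) A) (reflOp (zeroProj a n))

theorem commute_unitOp_boxWalk (hl : l ∉ Set.range a) (i j : Fin 2) (A : QOp (Fin m ⊕ Fin n)) :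
    Commute (unitOp (W := Fin M ⊕ Fin n) (Sum.inl l) i j) (boxWalk a A) := by
  have hR := commute_unitOp_reflOp (n := n) hl i j
  rw [boxWalk, walkOp, ← placeOp_conjTranspose]
  exact (((commute_unitOp_placeOp hl i j _).mul_right hR).mul_right
    (commute_unitOp_placeOp hl i j _)).mul_right hR

theorem commute_unitOp_boxWalk_conjTranspose (hl : l ∉ Set.range a) (i j : Fin 2)
    (A : QOp (Fin m ⊕ Fin n)) :
    Commute (unitOp (W := Fin M ⊕ Fin n) (Sum.inl l) i j) (boxWalk a A)ᴴ := by
  have h := congrArg Matrix.conjTranspose (commute_unitOp_boxWalk (n := n) hl j i A).eq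
  rw [Matrix.conjTranspose_mul, Matrix.conjTranspose_mul, unitOp_conjTranspose] at h
  exact h.symm

section
variable {W : Type} [Fintype W] [DecidableEq W] {q : W}

theorem controlled_mul {Y Z : QOp W} (hY : Commute (unitOp q 1 1) Y) :
    (unitOp q 0 0 + unitOp q 1 1 * Y) * (unitOp q 0 0 + unitOp q 1 1 * Z)
      = unitOp q 0 0 + unitOp q 1 1 * (Y * Z) := by
  have h01 : (0 : Fin 2) ≠ 1 := by decide
  rw [add_mul, mul_add, mul_add, unitOp_mul_same, ← mul_assoc (unitOp q 0 0),
    unitOp_mul_of_ne q 0 1 h01, hY.eq, mul_assoc Y, mul_assoc Y, unitOp_mul_of_ne q 1 0 h01.symm,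
    ← mul_assoc (unitOp q 1 1), unitOp_mul_same, ← mul_assoc Y, ← hY.eq, mul_assoc]
  simp

/-- Conjugation by X moves the control to the value 0, so that Y multiplies the first polynomial
only. -/
theorem mul_controlled_mul {Y F G : QOp W} (hY : ∀ i j, Commute (unitOp q i j) Y) :
    (mux q fun _ => pauliX) * (unitOp q 0 0 + unitOp q 1 1 * Y) * (mux q fun _ => pauliX) *
      (unitOp q 0 0 * F + unitOp q 1 0 * G) = unitOp q 0 0 * (Y * F) + unitOp q 1 0 * G := by
  have e : (mux q fun _ => pauliX) = unitOp q 0 1 + unitOp q 1 0 := by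
    rw [mux_const_eq]; simp [pauliX]
  have h1 : ∀ i j, Y * unitOp q i j = unitOp q i j * Y := fun i j => (hY i j).eq.symm
  have h2 : ∀ i j Z, Y * (unitOp q i j * Z) = unitOp q i j * (Y * Z) := fun i j Z => by
    rw [← mul_assoc, h1, mul_assoc]
  have h3 : ∀ i j k Z, unitOp q i j * (unitOp q j k * Z) = unitOp q i k * Z := fun i j k Z => by
    rw [← mul_assoc, unitOp_mul_same]
  have h4 : ∀ i k Z, unitOp q i 0 * (unitOp q 1 k * Z) = 0 := fun i k Z => by
    rw [← mul_assoc, unitOp_mul_of_ne q i k zero_ne_one, zero_mul]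
  have h5 : ∀ i k Z, unitOp q i 1 * (unitOp q 0 k * Z) = 0 := fun i k Z => by
    rw [← mul_assoc, unitOp_mul_of_ne q i k one_ne_zero, zero_mul]
  simp only [e, add_mul, mul_add, mul_assoc, h2, h3, h4, h5, add_zero, zero_add, mul_zero]

theorem controlled_pow {Y : QOp W} (hY : Commute (unitOp q 1 1) Y) (k : ℕ) :
    (unitOp q 0 0 + unitOp q 1 1 * Y) ^ k = unitOp q 0 0 + unitOp q 1 1 * Y ^ k := by
  induction k with
  | zero => simp [unitOp_add]
  | succ k ih => rw [pow_succ, ih, controlled_mul (hY.pow_right k), pow_succ]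

/-- Only the reflections need a control: when they are off, U†U cancels. Hence the queries to the
black box are uncontrolled. -/
theorem conj_controlled {U Y : QOp W} (h00 : Commute (unitOp q 0 0) U)
    (h11 : Commute (unitOp q 1 1) U) (hU : Uᴴ * U = 1) :
    Uᴴ * (unitOp q 0 0 + unitOp q 1 1 * Y) * U = unitOp q 0 0 + unitOp q 1 1 * (Uᴴ * Y * U) := by
  have h11' : Uᴴ * unitOp q 1 1 = unitOp q 1 1 * Uᴴ := by
    have := congrArg Matrix.conjTranspose h11.eq
    rwa [Matrix.conjTranspose_mul, Matrix.conjTranspose_mul, unitOp_conjTranspose] at this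
  rw [mul_add, add_mul, mul_assoc, h00.eq, ← mul_assoc, hU, one_mul, ← mul_assoc, h11']
  simp only [mul_assoc]

end

theorem QueryImpl.controlledWalk (hl : l ∉ Set.range a) (s : Fin n) :
    ∃ cX : QOp (Fin m ⊕ Fin n) → QOp (Fin M ⊕ Fin n), QueryImpl V₂ 2 (80 * m + 20) cX ∧
      ∀ A, A ∈ Matrix.unitaryGroup (Fin m ⊕ Fin n → Fin 2) ℂ →
        cX A = unitOp (Sum.inl l) 0 0 + unitOp (Sum.inl l) 1 1 * boxWalk a A := by
  have hR := QueryImpl.controlledReflection (V₂ := V₂) hl s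
  have hU := QueryImpl.query (V₂ := V₂) (ancillaEmb a n)
  have hU' := QueryImpl.queryInv (V₂ := V₂) (ancillaEmb a n)
  refine ⟨_, (((hU'.mul hR).mul hU).mul hR).mono (by omega) (by omega), fun A hA => ?_⟩
  have hU1 := Matrix.mem_unitaryGroup_iff'.mp (placeOp_mem_unitaryGroup (ancillaEmb a n) hA)
  rw [placeOp_conjTranspose, conj_controlled (commute_unitOp_placeOp hl 0 0 A)
    (commute_unitOp_placeOp hl 1 1 A) hU1, controlled_mul, boxWalk, walkOp]
  rw [← placeOp_conjTranspose]
  exact ((commute_unitOp_placeOp hl 1 1 _).mul_right (commute_unitOp_reflOp hl 1 1)).mul_right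
    (commute_unitOp_placeOp hl 1 1 _)

theorem QueryImpl.controlledWalkInv (hl : l ∉ Set.range a) (s : Fin n) :
    ∃ cX : QOp (Fin m ⊕ Fin n) → QOp (Fin M ⊕ Fin n), QueryImpl V₂ 2 (80 * m + 20) cX ∧
      ∀ A, A ∈ Matrix.unitaryGroup (Fin m ⊕ Fin n → Fin 2) ℂ →
        cX A = unitOp (Sum.inl l) 0 0 + unitOp (Sum.inl l) 1 1 * (boxWalk a A)ᴴ := by
  have hR := QueryImpl.controlledReflection (V₂ := V₂) hl s
  have hU := QueryImpl.query (V₂ := V₂) (ancillaEmb a n)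
  have hU' := QueryImpl.queryInv (V₂ := V₂) (ancillaEmb a n)
  refine ⟨_, (hR.mul ((hU'.mul hR).mul hU)).mono (by omega) (by omega), fun A hA => ?_⟩
  have hU1 := Matrix.mem_unitaryGroup_iff'.mp (placeOp_mem_unitaryGroup (ancillaEmb a n) hA)
  rw [placeOp_conjTranspose, conj_controlled (commute_unitOp_placeOp hl 0 0 A)
    (commute_unitOp_placeOp hl 1 1 A) hU1, controlled_mul (commute_unitOp_reflOp hl 1 1), boxWalk,
    walkOp]
  simp only [Matrix.conjTranspose_mul, Matrix.conjTranspose_conjTranspose,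
    reflOp_conjTranspose (zeroProj_conjTranspose a), mul_assoc]

open Polynomial in
/-- A circuit whose zero block is the odd polynomial `x * G(x²)` of the Hermitian zero block of `A`
times the zero block of an operator `V` applied first. -/
theorem exists_polynomial_circuit (hl : l ∉ Set.range a) (s : Fin n) {G : ℝ[X]}
    (hG : ∀ x : ℝ, |x| ≤ 1 → |x * G.eval (x ^ 2)| < 1) :
    ∃ O : QOp (Fin m ⊕ Fin n) → QOp (Fin M ⊕ Fin n),
      QueryImpl V₂ (6 * G.natDegree + 3) ((G.natDegree + 1) * (240 * m + 64)) O ∧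
      ∀ A, A ∈ Matrix.unitaryGroup (Fin m ⊕ Fin n → Fin 2) ℂ → (zeroBlock A)ᴴ = zeroBlock A →
        ∀ V : QOp (Fin M ⊕ Fin n), Commute (unitOp (Sum.inl l) 0 0) V →
          zeroBlock (O A * V) = zeroBlock A *
            aeval (zeroBlock A ^ 2) (G.map (algebraMap ℝ ℂ)) * (bra M n * V * (bra M n)ᴴ) := by
  obtain ⟨K, hK⟩ : ∃ K, K = G.natDegree := ⟨_, rfl⟩
  rw [← hK]
  have hdeg := natDegree_liftOdd_le K G
  obtain ⟨g, hg, hfg⟩ := exists_complementary_polynomial hdeg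
    fun z hz => norm_eval_liftOdd_lt_one hK.ge hG hz
  obtain ⟨cX, hcX, hcXe⟩ := QueryImpl.controlledWalk (V₂ := V₂) hl s
  obtain ⟨cY, hcY, hcYe⟩ := QueryImpl.controlledWalkInv (V₂ := V₂) hl s
  obtain ⟨S, hS, hSe⟩ := QueryImpl.signalProcessing hcX hcXe
    (fun A _ i j => commute_unitOp_boxWalk hl i j A) _ _ g hdeg hg hfg
  have hX := (ElemImpl.mux_const (V₁ := Fin m ⊕ Fin n) (V₂ := V₂) (Sum.inl l : Fin M ⊕ Fin n)
    pauliX_mem_unitaryGroup).queryImpl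
  have hU := QueryImpl.query (V₂ := V₂) (ancillaEmb a n)
  -- Signal processing puts `liftOdd` of W on the branch q = 0, then K inverse walks controlled on q
  -- = 0 shift it to a Laurent polynomial, and a final query gives the odd degree. The queries
  -- number 2(2K + 1) + 2K + 1 = 6K + 3.
  refine ⟨_, (hU.mul (((hX.mul (hcY.pow K)).mul hX).mul hS)).mono (by omega) (by nlinarith),
    fun A hA hh V hV => ?_⟩
  have hUu := placeOp_mem_unitaryGroup (ancillaEmb a n) hA
  have hYc := fun i j => commute_unitOp_boxWalk_conjTranspose (n := n) hl i j A
  have hmid : (mux (Sum.inl l : Fin M ⊕ Fin n) fun _ => pauliX) * cY A ^ K *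
      (mux (Sum.inl l) fun _ => pauliX) * (S A * unitOp (Sum.inl l) 0 0)
      = unitOp (Sum.inl l) 0 0 * ((boxWalk a A)ᴴ ^ K * aeval (boxWalk a A) (liftOdd K G))
        + unitOp (Sum.inl l) 1 0 * aeval (boxWalk a A) g := by
    rw [hSe A hA, hcYe A hA, controlled_pow (hYc 1 1),
      mul_controlled_mul fun i j => (hYc i j).pow_right K]
  have hket : unitOp (W := Fin M ⊕ Fin n) (Sum.inl l) 0 0 * (bra M n)ᴴ = (bra M n)ᴴ := by
    have := congrArg Matrix.conjTranspose (bra_mul_unitOp (n := n) l 0 0 fun _ => rfl)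
    rwa [if_pos rfl, Matrix.conjTranspose_mul, unitOp_conjTranspose] at this
  have hb00 : bra M n * unitOp (W := Fin M ⊕ Fin n) (Sum.inl l) 0 0 = bra M n := by
    simpa using bra_mul_unitOp (n := n) l 0 0 fun _ => rfl
  have hb10 : bra M n * unitOp (W := Fin M ⊕ Fin n) (Sum.inl l) 1 0 = 0 := by
    simpa using bra_mul_unitOp (n := n) l 1 0 (by decide)
  have hrow : bra M n * placeOp (ancillaEmb a n) A *
      ((mux (Sum.inl l : Fin M ⊕ Fin n) fun _ => pauliX) * cY A ^ K *
        (mux (Sum.inl l) fun _ => pauliX) * (S A * unitOp (Sum.inl l) 0 0))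
      = zeroBlock A * aeval (zeroBlock A ^ 2) (G.map (algebraMap ℝ ℂ)) * bra M n := by
    have hb0 : bra M n * placeOp (ancillaEmb a n) A * unitOp (W := Fin M ⊕ Fin n) (Sum.inl l) 0 0
        = bra M n * placeOp (ancillaEmb a n) A := by
      rw [Matrix.mul_assoc, ← (commute_unitOp_placeOp hl 0 0 A).eq, ← Matrix.mul_assoc, hb00]
    have hb1 : bra M n * placeOp (ancillaEmb a n) A * unitOp (W := Fin M ⊕ Fin n) (Sum.inl l) 1 0 = 0 := by
      rw [Matrix.mul_assoc, ← (commute_unitOp_placeOp hl 1 0 A).eq, ← Matrix.mul_assoc, hb10,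
        Matrix.zero_mul]
    rw [hmid, Matrix.mul_add, ← Matrix.mul_assoc _ (unitOp _ 0 0), ← Matrix.mul_assoc _ (unitOp _ 1 0),
      hb0, hb1, Matrix.zero_mul, add_zero]
    refine row_mul_aeval_liftOdd (zeroProj_conjTranspose a) (zeroProj_mul_self a)
      (bra_mul_zeroProj a) (bra_mul_placeOp_mul_zeroProj a A) ?_
      (Matrix.mem_unitaryGroup_iff.mp hUu) hK.ge
    rw [← placeOp_conjTranspose, bra_mul_placeOp_mul_zeroProj, zeroBlock_conjTranspose, hh]
  -- V leaves the control qubit in state 0, which is all that the row identity `hrow` requires of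
  -- its input.
  have hVk : V * (bra M n)ᴴ = unitOp (W := Fin M ⊕ Fin n) (Sum.inl l) 0 0 * (V * (bra M n)ᴴ) := by
    rw [← Matrix.mul_assoc, hV.eq, Matrix.mul_assoc, hket]
  rw [zeroBlock_eq, Matrix.mul_assoc, Matrix.mul_assoc _ V, hVk]
  simp only [← Matrix.mul_assoc] at hrow ⊢
  rw [hrow]

end ControlledWalk

/-! ### Functional calculus and the Moore–Penrose inverse -/

section SpectralEstimate

open Polynomial

variable {ι : Type*} [Fintype ι] [DecidableEq ι]

theorem pinv_eq_of_isMoorePenrose {A B : Matrix ι ι ℂ} (h : IsMoorePenrose A B) : pinv A = B :=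
  (pinv_spec A).unique h

theorem aeval_diagonal (d : ι → ℂ) (p : ℂ[X]) :
    aeval (Matrix.diagonal d) p = Matrix.diagonal fun i => p.eval (d i) := by
  have h := aeval_algHom_apply (Matrix.diagonalAlgHom ℂ) d p
  have h2 : aeval d p = fun i => p.eval (d i) := by
    funext i
    simp
  rw [h2] at h
  exact h

/-- All the operators are diagonal in an eigenbasis of H. The convention 0⁻¹ = 0 makes x⁻¹ the
eigenvalue of the Moore–Penrose inverse at x = 0 as well. -/
theorem norm_smul_polynomial_sub_smul_pinv_le {H h : Matrix ι ι ℂ} (hH : H.IsHermitian) {α a b ε : ℝ}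
    (hα : 0 < α) (hh : H = (α : ℂ) • h) (hε : 0 ≤ ε) {G : ℝ[X]}
    (hG : ∀ x : ℝ, x ∈ spectrum ℝ H → |a * (x / α * G.eval ((x / α) ^ 2)) - b * x⁻¹| ≤ ε) :
    ‖(a : ℂ) • (h * aeval (h ^ 2) (G.map (algebraMap ℝ ℂ))) - (b : ℂ) • pinv H‖ ≤ ε := by
  set d := hH.eigenvalues with hd
  set u := hH.eigenvectorUnitary
  set φ := Unitary.conjStarAlgAut ℂ (Matrix ι ι ℂ) u with hφ
  have hs : H = φ (Matrix.diagonal fun i => (d i : ℂ)) := hH.spectral_theorem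
  have hα' : (α : ℂ) ≠ 0 := Complex.ofReal_ne_zero.mpr hα.ne'
  have hhd : h = φ (Matrix.diagonal fun i => ((d i / α : ℝ) : ℂ)) := by
    have : h = (α : ℂ)⁻¹ • H := by rw [hh, smul_smul, inv_mul_cancel₀ hα', one_smul]
    rw [this, hs, ← map_smul, ← Matrix.diagonal_smul]
    congr 2
    funext i
    simp [div_eq_inv_mul]
  have hp : pinv H = φ (Matrix.diagonal fun i => ((d i)⁻¹ : ℂ)) := by
    apply pinv_eq_of_isMoorePenrose
    rw [hs]
    constructor
    · rw [← map_mul, ← map_mul, Matrix.diagonal_mul_diagonal, Matrix.diagonal_mul_diagonal]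
      simp only [mul_inv_mul_cancel]
    · rw [← map_mul, ← map_mul, Matrix.diagonal_mul_diagonal, Matrix.diagonal_mul_diagonal]
      congr 2
      funext i
      by_cases h : (d i : ℂ) = 0 <;> simp [h]
    · rw [← map_mul, ← Matrix.star_eq_conjTranspose, ← map_star, Matrix.star_eq_conjTranspose,
        Matrix.diagonal_mul_diagonal, Matrix.diagonal_conjTranspose]
      congr 2
      funext i
      simp
    · rw [← map_mul, ← Matrix.star_eq_conjTranspose, ← map_star, Matrix.star_eq_conjTranspose,
        Matrix.diagonal_mul_diagonal, Matrix.diagonal_conjTranspose]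
      congr 2
      funext i
      simp
  rw [hp, hhd, ← map_pow, aeval_algHom_apply, ← map_mul, ← map_smul, ← map_smul, ← map_sub,
    Matrix.diagonal_pow, aeval_diagonal, Matrix.diagonal_mul_diagonal, ← Matrix.diagonal_smul,
    ← Matrix.diagonal_smul, Matrix.diagonal_sub, hφ, Unitary.conjStarAlgAut_apply,
    ← Unitary.coe_star, CStarRing.norm_mul_coe_unitary, CStarRing.norm_coe_unitary_mul,
    Matrix.l2_opNorm_diagonal, pi_norm_le_iff_of_nonneg hε]
  intro i
  have hi := hG (d i) (hH.eigenvalues_mem_spectrum_real i)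
  rw [← Real.norm_eq_abs, ← Complex.norm_real] at hi
  have e : eval (((d i / α : ℝ) : ℂ) ^ 2) (G.map (algebraMap ℝ ℂ))
      = ((G.eval ((d i / α) ^ 2) : ℝ) : ℂ) := by
    rw [← Complex.ofReal_pow, eval_map]
    exact eval₂_at_apply (algebraMap ℝ ℂ) _
  refine le_of_eq_of_le (congrArg norm ?_) hi
  simp only [Pi.smul_apply, Pi.pow_apply, smul_eq_mul, e]
  push_cast
  rfl

end SpectralEstimate

/-! ### Spectrum of the shifted Hamiltonian -/

section GroundLevels

variable {n : ℕ} {H : QOp (Fin n)} {E₀ E₁ : ℝ}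

theorem HasGroundLevels.sub_isHermitian (h : HasGroundLevels H E₀ E₁) :
    (H - (E₀ : ℂ) • (1 : QOp (Fin n))).IsHermitian := by
  rw [Matrix.IsHermitian, Matrix.conjTranspose_sub, h.hermitian.eq, Matrix.conjTranspose_smul,
    Matrix.conjTranspose_one, Complex.star_def, Complex.conj_ofReal]

theorem mem_spectrum_sub_iff {x : ℝ} :
    x ∈ spectrum ℝ (H - (E₀ : ℂ) • (1 : QOp (Fin n))) ↔ x + E₀ ∈ spectrum ℝ H := by
  have e : (E₀ : ℂ) • (1 : QOp (Fin n)) = algebraMap ℝ (QOp (Fin n)) E₀ := by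
    rw [Algebra.algebraMap_eq_smul_one, Complex.coe_smul]
  rw [spectrum.mem_iff, spectrum.mem_iff, e, map_add]
  congr! 2
  abel

theorem HasGroundLevels.eq_zero_or_le (h : HasGroundLevels H E₀ E₁) {x : ℝ}
    (hx : x ∈ spectrum ℝ (H - (E₀ : ℂ) • (1 : QOp (Fin n)))) : x = 0 ∨ E₁ - E₀ ≤ x := by
  rw [mem_spectrum_sub_iff] at hx
  by_cases h0 : x = 0
  · exact Or.inl h0
  · have := h.excited.2 ⟨hx, fun h' => h0 (by simpa using h')⟩
    exact Or.inr (by linarith)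

theorem HasGroundLevels.sub_mem_spectrum (h : HasGroundLevels H E₀ E₁) :
    E₁ - E₀ ∈ spectrum ℝ (H - (E₀ : ℂ) • (1 : QOp (Fin n))) := by
  rw [mem_spectrum_sub_iff, sub_add_cancel]
  exact h.excited.1.1

theorem HasGroundLevels.le_norm (h : HasGroundLevels H E₀ E₁) :
    E₁ - E₀ ≤ ‖H - (E₀ : ℂ) • (1 : QOp (Fin n))‖ :=
  (le_abs_self _).trans (spectrum.norm_le_norm_of_mem h.sub_mem_spectrum)

theorem HasGroundLevels.pos (h : HasGroundLevels H E₀ E₁) : 0 < n := by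
  by_contra hn
  obtain rfl : n = 0 := by omega
  have h1 := h.excited.1
  have h0 := h.ground.1
  rw [h.hermitian.spectrum_real_eq_range_eigenvalues] at h0 h1
  obtain ⟨i, hi⟩ := h0
  obtain ⟨⟨j, hj⟩, hne⟩ := h1
  exact hne (hj.symm.trans ((congrArg _ (Subsingleton.elim j i)).trans hi))

end GroundLevels

/-! ### Norm bounds and assembly of the theorem -/

section Main

variable {M n : ℕ}

theorem norm_bra_le : ‖bra M n‖ ≤ 1 := by
  have h := Matrix.l2_opNorm_conjTranspose_mul_self (bra M n)ᴴ
  have e : bra M n * (bra M n)ᴴ = 1 := by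
    ext x y
    rw [mul_bra_conjTranspose_apply, bra_apply, Matrix.one_apply]
    refine if_congr ⟨fun h => funext fun i => congrFun h (Sum.inr i), fun h => by rw [h]⟩ rfl rfl
  rw [Matrix.conjTranspose_conjTranspose, e, Matrix.l2_opNorm_conjTranspose, norm_one] at h
  nlinarith [norm_nonneg (bra M n)]

theorem norm_zeroBlock_le_one {U : QOp (Fin M ⊕ Fin n)}
    (hU : U ∈ Matrix.unitaryGroup (Fin M ⊕ Fin n → Fin 2) ℂ) : ‖zeroBlock U‖ ≤ 1 := by
  have hb := norm_bra_le (M := M) (n := n)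
  have hUn : ‖U‖ ≤ 1 := (CStarRing.norm_of_mem_unitary hU).le
  rw [zeroBlock_eq]
  calc ‖bra M n * U * (bra M n)ᴴ‖ ≤ ‖bra M n * U‖ * ‖(bra M n)ᴴ‖ := Matrix.l2_opNorm_mul _ _
    _ ≤ (‖bra M n‖ * ‖U‖) * ‖bra M n‖ := by
        rw [Matrix.l2_opNorm_conjTranspose]
        gcongr
        exact Matrix.l2_opNorm_mul _ _
    _ ≤ (1 * 1) * 1 := by gcongr
    _ = 1 := by norm_num

theorem IsBlockEncoding.eq_smul {α : ℝ} {A : QOp (Fin n)} {U : QOp (Fin M ⊕ Fin n)}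
    (h : IsBlockEncoding α M 0 A U) : A = (α : ℂ) • zeroBlock U :=
  sub_eq_zero.mp (norm_le_zero_iff.mp h.error_le)

theorem isBlockEncoding_smul_zeroBlock {α : ℝ} (hα : 0 ≤ α) {U : QOp (Fin M ⊕ Fin n)}
    (hU : U ∈ Matrix.unitaryGroup (Fin M ⊕ Fin n → Fin 2) ℂ) :
    IsBlockEncoding α M 0 ((α : ℂ) • zeroBlock U) U := by
  refine ⟨hU, ?_, by rw [sub_self, norm_zero]⟩
  rw [norm_smul, Complex.norm_real, Real.norm_of_nonneg hα]
  exact mul_le_of_le_one_right hα (norm_zeroBlock_le_one hU)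

/-- For α_I = 0 the argument of the logarithm is 0 and `Real.log 0 = 0`, so the maximum is 1, in
accordance with the convention L = 1. -/
theorem mul_exp_neg_max_log_le {αI Δ ε : ℝ} (hI : 0 ≤ αI) (hΔ : 0 < Δ) (hε : 0 < ε) :
    αI / Δ * Real.exp (-max 1 (Real.log (αI / (Δ * ε)))) ≤ ε := by
  rcases hI.eq_or_lt with rfl | hI
  · simpa using hε.le
  have h1 : Real.exp (-max 1 (Real.log (αI / (Δ * ε)))) ≤ (αI / (Δ * ε))⁻¹ := by
    rw [← Real.exp_log (by positivity : 0 < αI / (Δ * ε)), ← Real.exp_neg,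
      Real.exp_log (by positivity)]
    exact Real.exp_le_exp.mpr (neg_le_neg (le_max_right _ _))
  calc αI / Δ * Real.exp (-max 1 (Real.log (αI / (Δ * ε)))) ≤ αI / Δ * (αI / (Δ * ε))⁻¹ := by gcongr
    _ = ε := by field_simp

theorem mainTheorem3 :
    ∃ C : ℝ, 0 < C ∧
      ∀ (n m₁ m₂ : ℕ) (αH αI Δ ε : ℝ), 0 < αH → 0 ≤ αI → 0 < Δ → 0 < ε → ε ≤ 1 / 2 →
        ∃ c : OracleCircuit (Fin m₁ ⊕ Fin n) (Fin m₂ ⊕ Fin n) (Fin (m₁ + m₂ + 1) ⊕ Fin n),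
          (c.queryACount : ℝ) ≤ C * (αH / Δ * max 1 (Real.log (αI / (Δ * ε)))) ∧
          c.queryBCount = 1 ∧
          c.queryBInvCount = 0 ∧
          (c.elementaryCount : ℝ) ≤
            C * ((n + m₁ + m₂ + 1 : ℝ) * (αH / Δ) * max 1 (Real.log (αI / (Δ * ε)))) ∧
          ∀ (H HI : QOp (Fin n)) (E₀ E₁ : ℝ)
            (UH : QOp (Fin m₁ ⊕ Fin n)) (UI : QOp (Fin m₂ ⊕ Fin n)),
            HasGroundLevels H E₀ E₁ → Δ ≤ E₁ - E₀ →
            IsBlockEncoding αH m₁ 0 (H - (E₀ : ℂ) • (1 : QOp (Fin n))) UH →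
            IsBlockEncoding αI m₂ 0 HI UI →
            ∃ Q : QOp (Fin n),
              IsBlockEncoding (4 * αI / (3 * Δ)) (m₁ + m₂ + 1) 0 Q (c.toOp UH UI) ∧
              ‖Q - pinv (H - (E₀ : ℂ) • (1 : QOp (Fin n))) * HI‖ ≤ ε := by
  -- The degree bound 30000 (α_H/Δ)L leads to the constants 180003 for the queries and 30001 · 240 =
  -- 7200240 for the elementary gates.
  refine ⟨10000000, by norm_num, ?_⟩
  intro n m₁ m₂ αH αI Δ ε hαH hαI hΔ hε _
  set L : ℝ := max 1 (Real.log (αI / (Δ * ε))) with hL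
  have hL1 : 1 ≤ L := le_max_left _ _
  let a : Fin m₁ ↪ Fin (m₁ + m₂ + 1) :=
    ⟨fun i => ⟨i, by omega⟩, fun i j h => by simpa [Fin.ext_iff] using h⟩
  let b : Fin m₂ ↪ Fin (m₁ + m₂ + 1) :=
    ⟨fun i => ⟨m₁ + i, by omega⟩, fun i j h => by simpa [Fin.ext_iff] using h⟩
  let V : OracleGate (Fin m₁ ⊕ Fin n) (Fin m₂ ⊕ Fin n) (Fin (m₁ + m₂ + 1) ⊕ Fin n) :=
    OracleGate.queryB (ancillaEmb b n)
  -- In these cases no Hamiltonian meets the hypotheses, since Δ ≤ E₁ - E₀ ≤ ‖H - E₀‖ ≤ α_H and a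
  -- one-dimensional space has no second level. A single query to U_I suffices. Otherwise δ ≤ 1, and
  -- a system qubit can serve as the borrowed wire.
  by_cases hdeg : n = 0 ∨ αH < Δ
  · refine ⟨[V], ?_, rfl, rfl, ?_, ?_⟩
    · have : OracleCircuit.queryACount [V] = 0 := rfl
      rw [this]
      have : 0 ≤ αH / Δ * L := by positivity
      push_cast
      linarith
    · have : OracleCircuit.elementaryCount [V] = 0 := rfl
      rw [this]
      have : 0 ≤ (n + m₁ + m₂ + 1 : ℝ) * (αH / Δ) * L := by positivity
      push_cast
      linarith
    · intro H HI E₀ E₁ UH UI hH hgap hUH _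
      exfalso
      rcases hdeg with h | h
      · exact hH.pos.ne' h
      · have := hH.le_norm.trans hUH.norm_le
        linarith
  push Not at hdeg
  obtain ⟨hn, hΔα⟩ := hdeg
  have hδ0 : 0 < Δ / αH := by positivity
  have hδ1 : Δ / αH ≤ 1 := (div_le_one hαH).mpr hΔα
  obtain ⟨G, hGd, hG1, hG2⟩ := exists_odd_approx_inv hδ0 hδ1 hL1
  have hla : Fin.last (m₁ + m₂) ∉ Set.range a := by
    rintro ⟨i, hi⟩
    have h1 : (i : ℕ) = m₁ + m₂ := congrArg Fin.val hi
    have := i.2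
    omega
  have hlb : Fin.last (m₁ + m₂) ∉ Set.range b := by
    rintro ⟨i, hi⟩
    have h1 : m₁ + (i : ℕ) = m₁ + m₂ := congrArg Fin.val hi
    have := i.2
    omega
  obtain ⟨O, ⟨c, c1, c2, c3, c4, c5⟩, hO⟩ := exists_polynomial_circuit (V₂ := Fin m₂ ⊕ Fin n) hla
    (⟨0, Nat.pos_of_ne_zero hn⟩ : Fin n) hG1
  have hx : L / (Δ / αH) = αH / Δ * L := by field_simp
  rw [hx] at hGd
  have hx1 : 1 ≤ αH / Δ * L := one_le_mul_of_one_le_of_one_le ((one_le_div hΔ).mpr hΔα) hL1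
  refine ⟨V :: c, ?_, ?_, ?_, ?_, ?_⟩
  · have e : OracleCircuit.queryACount (V :: c) = c.queryACount :=
      List.countP_cons_of_neg Bool.false_ne_true
    rw [e]
    have : (c.queryACount : ℝ) ≤ 6 * G.natDegree + 3 := by exact_mod_cast c1
    linarith
  · have e : OracleCircuit.queryBCount (V :: c) = c.queryBCount + 1 := List.countP_cons_of_pos rfl
    rw [e, c2]
  · have e : OracleCircuit.queryBInvCount (V :: c) = c.queryBInvCount :=
      List.countP_cons_of_neg Bool.false_ne_true
    rw [e, c3]
  · have e : OracleCircuit.elementaryCount (V :: c) = c.elementaryCount :=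
      List.countP_cons_of_neg Bool.false_ne_true
    rw [e]
    have h1 : (c.elementaryCount : ℝ) ≤ (G.natDegree + 1) * (240 * m₁ + 64) := by
      exact_mod_cast c4
    calc (c.elementaryCount : ℝ) ≤ (G.natDegree + 1) * (240 * m₁ + 64) := h1
      _ ≤ (30001 * (αH / Δ * L)) * (240 * (n + m₁ + m₂ + 1)) := by
          gcongr
          · linarith
          · have : (0 : ℝ) ≤ n := Nat.cast_nonneg n
            have : (0 : ℝ) ≤ m₂ := Nat.cast_nonneg m₂
            linarith
      _ = 7200240 * ((n + m₁ + m₂ + 1 : ℝ) * (αH / Δ) * L) := by ring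
      _ ≤ 10000000 * ((n + m₁ + m₂ + 1 : ℝ) * (αH / Δ) * L) := by
          gcongr
          norm_num
  · intro H HI E₀ E₁ UH UI hH hgap hUH hUI
    have hU := OracleCircuit.toOp_mem_unitaryGroup hUH.unitary hUI.unitary (V :: c)
    have hα : 0 ≤ 4 * αI / (3 * Δ) := by positivity
    refine ⟨_, isBlockEncoding_smul_zeroBlock hα hU, ?_⟩
    have hHe := hUH.eq_smul
    have hself : (zeroBlock UH)ᴴ = zeroBlock UH := by
      have h1 := hH.sub_isHermitian.eq
      rw [hHe, Matrix.conjTranspose_smul, Complex.star_def, Complex.conj_ofReal] at h1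
      exact smul_right_injective _ (Complex.ofReal_ne_zero.mpr hαH.ne') h1
    have htop : OracleCircuit.toOp UH UI (V :: c) = O UH * placeOp (ancillaEmb b n) UI := by
      rw [← c5 UH UI]
      rfl
    rw [htop, hO UH hUH.unitary hself _ (commute_unitOp_placeOp hlb 0 0 UI),
      bra_mul_placeOp_mul_conjTranspose]
    rw [hUI.eq_smul]
    -- The factor α_I of H_I moves to the Moore–Penrose inverse, so that the difference is an
    -- operator depending on H times the zero block of U_I, a contraction.
    rw [Matrix.mul_smul, ← Matrix.smul_mul (αI : ℂ), ← Matrix.smul_mul (_ : ℂ) (_ * _), ← Matrix.sub_mul]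
    refine (Matrix.l2_opNorm_mul _ _).trans ((mul_le_of_le_one_right (norm_nonneg _)
      (norm_zeroBlock_le_one hUI.unitary)).trans ?_)
    refine norm_smul_polynomial_sub_smul_pinv_le hH.sub_isHermitian hαH hHe hε.le fun x hx => ?_
    -- At the ground level both the odd polynomial and 0⁻¹ vanish; elsewhere x/α_H lies in [δ, 1].
    rcases hH.eq_zero_or_le hx with rfl | hxle
    · simpa using hε.le
    have hxΔ : Δ ≤ x := hgap.trans hxle
    have hx0 : 0 < x := by linarith
    have hxα : x ≤ αH := (le_abs_self x).trans
      ((spectrum.norm_le_norm_of_mem hx).trans hUH.norm_le)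
    have h2 := hG2 (x / αH) (by gcongr) ((div_le_one hαH).mpr hxα)
    have e : 4 * αI / (3 * Δ) * (x / αH * G.eval ((x / αH) ^ 2)) - αI * x⁻¹
        = 4 * αI / (3 * Δ) * (x / αH * G.eval ((x / αH) ^ 2) - 3 / 4 * (Δ / αH) / (x / αH)) := by
      field_simp
    rw [e, abs_mul, abs_of_nonneg hα]
    calc _ ≤ 4 * αI / (3 * Δ) * (3 / 4 * Real.exp (-L)) := by gcongr
      _ = αI / Δ * Real.exp (-L) := by field_simp
      _ ≤ ε := mul_exp_neg_max_log_le hαI hΔ hε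

end Main
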